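/- **Setting.** A divisor sequence method $\mathcal R$ is given by a real sequence $d_1<d_2<d_3<\cdots$ with $d_1\ge 1$, where $d_i$ is bounded by a polynomial in $i$ and is computable in time polynomial in $i$. The latter means that $d_i$ is rational and a numerator and a denominator of $d_i$ can be computed in time polynomial in $i$; or, more generally for possibly irrational values, that it can be decided in time polynomial in $a+b+i+j$ whether $a\,d_j\le b\,d_i$, for natural numbers $a,b\ge 0$ and $i,j\ge 1$. An election consists of parties $P_1,\dots,P_m$ and a list of $n$ votes, each a strict ranking of the parties. Given a threshold $\tau\in\mathbb N$, the support $\sigma(P)$ of a party $P$ is the number of votes that rank $P$ first if this number is at least $\tau$, and $0$ otherwise. With $\kappa$ seats, consider all fractions $\sigma(P)/d_j$ with $P$ a party and $1\le j\le\kappa$. Under $\mathcal R$ each party receives one seat for each of its fractions among the $\kappa$ highest ones, where ties are broken in favor of the party with the lowest index; parties with support $0$ receive no seat (so no seats are assigned if no party has positive support). The problem **$\mathcal R$-Destructive-Apportionment-Bribery ($\mathcal R$-DAB)** is the following. *Given:* an election with $m$ parties and $n$ votes, where $n>m$ and all votes are listed explicitly, a threshold $\tau\in\mathbb N$, a number of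 seats $\kappa$ with $0\le\kappa<n$, a distinguished party $P^*$, a number $\ell$ with $0\le \ell\le\kappa$, and a budget $K$ with $0\le K\le n$. *Question:* is it possible to change at most $K$ of the votes (each into an arbitrary ranking) such that $P^*$ receives at most $\ell$ seats under $\mathcal R$? **Theorem.** For every divisor sequence method $\mathcal R$, the problem $\mathcal R$-DAB is in $\mathrm P$, i.e., it can be decided in time polynomial in the size of the instance. -/

import Mathlib

/-! ### Random access machines with a step count, and the class P -/

namespace RAM

/-- Programs of a random access machine with unit costs, written with structured control flow.
A program uses finitely many variables `x, y, z` and finitely many unbounded arrays `a`, named by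
natural numbers; all of them hold natural numbers. The arithmetic is addition, truncated
subtraction and halving, so one step makes the largest number at most one bit longer, and unit
costs are polynomially equivalent to the running time of a Turing machine. -/
inductive Prog : Type
  /-- `x := c` -/
  | const (x c : ℕ) : Prog
  /-- `x := y + z` -/
  | plus (x y z : ℕ) : Prog
  /-- `x := y - z`, and `x := 0` if `y < z` -/
  | minus (x y z : ℕ) : Prog
  /-- `x := ⌊y / 2⌋` -/
  | half (x y : ℕ) : Prog
  /-- `x := a[y]` -/
  | load (x a y : ℕ) : Prog
  /-- `a[x] := y` -/
  | store (a x y : ℕ) : Prog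
  /-- all entries of the array `a` become `0` -/
  | clear (a : ℕ) : Prog
  /-- first `p`, then `q` -/
  | seq (p q : Prog) : Prog
  /-- `p` if `x ≠ 0`, and `q` if `x = 0` -/
  | cond (x : ℕ) (p q : Prog) : Prog
  /-- repeat `p` as long as `x ≠ 0` -/
  | loop (x : ℕ) (p : Prog) : Prog

/-- The memory: the contents of the variables and of the arrays. -/
@[ext] structure State : Type where
  var : ℕ → ℕ
  arr : ℕ → ℕ → ℕ

/-- `x := v` -/
def State.setVar (s : State) (x v : ℕ) : State :=
  { s with var := Function.update s.var x v }

/-- `a := f`, for a whole array -/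
def State.setArr (s : State) (a : ℕ) (f : ℕ → ℕ) : State :=
  { s with arr := Function.update s.arr a f }

/-- `Runs p s s' t`: started in the state `s`, the program `p` halts after exactly `t` steps, in
the state `s'`. Every instruction and every test of a branch or of a loop is one step. -/
inductive Runs : Prog → State → State → ℕ → Prop
  | const (x c : ℕ) (s : State) : Runs (.const x c) s (s.setVar x c) 1
  | plus (x y z : ℕ) (s : State) : Runs (.plus x y z) s (s.setVar x (s.var y + s.var z)) 1
  | minus (x y z : ℕ) (s : State) : Runs (.minus x y z) s (s.setVar x (s.var y - s.var z)) 1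
  | half (x y : ℕ) (s : State) : Runs (.half x y) s (s.setVar x (s.var y / 2)) 1
  | load (x a y : ℕ) (s : State) : Runs (.load x a y) s (s.setVar x (s.arr a (s.var y))) 1
  | store (a x y : ℕ) (s : State) :
      Runs (.store a x y) s (s.setArr a (Function.update (s.arr a) (s.var x) (s.var y))) 1
  | clear (a : ℕ) (s : State) : Runs (.clear a) s (s.setArr a fun _ => 0) 1
  | seq {p q : Prog} {s s' s'' : State} {t t' : ℕ} :
      Runs p s s' t → Runs q s' s'' t' → Runs (.seq p q) s s'' (t + t')
  | cond_true {x : ℕ} {p q : Prog} {s s' : State} {t : ℕ} :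
      s.var x ≠ 0 → Runs p s s' t → Runs (.cond x p q) s s' (t + 1)
  | cond_false {x : ℕ} {p q : Prog} {s s' : State} {t : ℕ} :
      s.var x = 0 → Runs q s s' t → Runs (.cond x p q) s s' (t + 1)
  | loop_true {x : ℕ} {p : Prog} {s s' s'' : State} {t t' : ℕ} :
      s.var x ≠ 0 → Runs p s s' t → Runs (.loop x p) s' s'' t' →
      Runs (.loop x p) s s'' (t + t' + 1)
  | loop_false {x : ℕ} {p : Prog} {s : State} :
      s.var x = 0 → Runs (.loop x p) s s 1

/-- The initial state on the input `w`: array `0` holds the entries of `w`, variable `0` holds the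
length of `w`, and everything else is `0`. -/
def start (w : List ℕ) : State where
  var := Function.update (fun _ => 0) 0 w.length
  arr := Function.update (fun _ _ => 0) 0 fun i => w.getD i 0

/-- The size of an input: the number of bits of its entries in binary, plus one for each entry. -/
def inputSize (w : List ℕ) : ℕ := (w.map fun k => k.size + 1).sum

/-- The decision problem with instances `x : α`, encoded by `enc`, and question `Q x` is in P: some
program answers it on every instance, in time polynomial in the size of the encoded instance. The
answer is "yes" if and only if variable `0` is nonzero at the end. -/
def InP {α : Type} (enc : α → List ℕ) (Q : α → Prop) : Prop :=
  ∃ (p : Prog) (T : Polynomial ℕ), ∀ x : α, ∃ (s : State) (t : ℕ),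
    Runs p (start (enc x)) s t ∧ t ≤ T.eval (inputSize (enc x)) ∧ (s.var 0 ≠ 0 ↔ Q x)

end RAM

/-! ### Divisor sequence methods -/

namespace Apportionment

/-- The values `d i`, `i ≥ 1`, are fractions of natural numbers, and numerator and denominator of
`d i` can be computed (into the variables `0` and `1`) in time polynomial in `i`. -/
def FractionComputable (d : ℕ → ℝ) : Prop :=
  ∃ (p : RAM.Prog) (T : Polynomial ℕ), ∀ i : ℕ, 1 ≤ i → ∃ (s : RAM.State) (t : ℕ),
    RAM.Runs p (RAM.start [i]) s t ∧ t ≤ T.eval i ∧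
      s.var 1 ≠ 0 ∧ d i = (s.var 0 : ℝ) / (s.var 1 : ℝ)

/-- The real values `d i`, `i ≥ 1`, which may be irrational, are given exactly by comparisons: it
can be decided in time polynomial in `a + b + i + j` whether `a * d j ≤ b * d i`. -/
def ComparisonComputable (d : ℕ → ℝ) : Prop :=
  ∃ (p : RAM.Prog) (T : Polynomial ℕ), ∀ a b i j : ℕ, 1 ≤ i → 1 ≤ j →
    ∃ (s : RAM.State) (t : ℕ), RAM.Runs p (RAM.start [a, b, i, j]) s t ∧
      t ≤ T.eval (a + b + i + j) ∧ (s.var 0 ≠ 0 ↔ (a : ℝ) * d j ≤ (b : ℝ) * d i)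

/-- The sequence `d 1, d 2, d 3, …` defines a divisor sequence method. (The value `d 0` is not
used.) -/
structure IsDivisorSequence (d : ℕ → ℝ) : Prop where
  one_le : 1 ≤ d 1
  lt_of_lt : ∀ i j : ℕ, 1 ≤ i → i < j → d i < d j
  bounded : ∃ B : Polynomial ℕ, ∀ i : ℕ, 1 ≤ i → d i ≤ (B.eval i : ℕ)
  computable : FractionComputable d ∨ ComparisonComputable d

/-- A vote: a strict ranking of the parties. It maps position `0` to the most preferred party,
position `1` to the second one, and so on. -/
abbrev Ranking (m : ℕ) : Type := Equiv.Perm (Fin m)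

/-- The party `P` is the top choice of the vote `r`. -/
def IsTop {m : ℕ} (r : Ranking m) (P : Fin m) : Prop := ((r.symm P : Fin m) : ℕ) = 0

open Classical in
/-- The number of votes with top choice `P`. -/
noncomputable def topCount {m n : ℕ} (V : Fin n → Ranking m) (P : Fin m) : ℕ :=
  (Finset.univ.filter fun i => IsTop (V i) P).card

open Classical in
/-- The support allocation in the top-choice mode, with threshold `τ`. -/
noncomputable def support {m n : ℕ} (V : Fin n → Ranking m) (τ : ℕ) (P : Fin m) : ℕ :=
  if τ ≤ topCount V P then topCount V P else 0

/-- For `x = (P, j)` and `y = (Q, k)`: the `j`-th entry `σ P / d j` of the fraction list of `P`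
comes before the `k`-th entry `σ Q / d k` of the fraction list of `Q`. The larger value comes
first; ties are broken in favor of the party with the lower index, and within one list (where they
only occur between zeros) in favor of the earlier entry. -/
def Before (d : ℕ → ℝ) {m : ℕ} (σ : Fin m → ℕ) (x y : Fin m × ℕ) : Prop :=
  (σ y.1 : ℝ) / d y.2 < (σ x.1 : ℝ) / d x.2 ∨
    ((σ x.1 : ℝ) / d x.2 = (σ y.1 : ℝ) / d y.2 ∧ (x.1 < y.1 ∨ (x.1 = y.1 ∧ x.2 < y.2)))

open Classical in
/-- The number of seats of `P` under the divisor sequence method of `d` with `κ` seats and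
lexicographic tie-breaking: the number of entries of the fraction list of `P` that are among the
`κ` first ones of all entries. A party without support gets no seat; this needs to be said only for
the case that no party has any support, since otherwise the `κ` first entries are positive. -/
noncomputable def seats (d : ℕ → ℝ) {m : ℕ} (σ : Fin m → ℕ) (κ : ℕ) (P : Fin m) : ℕ :=
  ((Finset.Icc 1 κ).filter fun j => 0 < σ P ∧
    (((Finset.univ : Finset (Fin m)) ×ˢ Finset.Icc 1 κ).filter
      fun y => Before d σ y (P, j)).card < κ).card

/-! ### Destructive apportionment bribery -/

/-- An instance of Destructive-Apportionment-Bribery: an election with `m` parties and `n` votes,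
having more votes than parties and more votes than seats, a threshold `τ`, a seat count `κ`, a
distinguished party `target`, a number of seats `ℓ`, and a budget `K`. -/
structure DAB : Type where
  m : ℕ
  n : ℕ
  votes : Fin n → Ranking m
  τ : ℕ
  κ : ℕ
  target : Fin m
  ℓ : ℕ
  K : ℕ
  parties_lt : m < n
  seats_lt : κ < n
  ℓ_le : ℓ ≤ κ
  K_le : K ≤ n

/-- The encoding of an instance: the numbers of the instance, and then all votes one after the
other, each of them as the list of the parties from most to least preferred. -/
def DAB.encode (I : DAB) : List ℕ :=
  [I.m, I.n, I.τ, I.κ, (I.target : ℕ), I.ℓ, I.K] ++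
    (List.ofFn fun i => List.ofFn fun j => ((I.votes i j : Fin I.m) : ℕ)).flatten

open Classical in
/-- The question: the distinguished party gets at most `ℓ` seats under the divisor sequence method
of `d` after at most `K` votes were changed, in any way. -/
def DAB.HasSuccessfulCampaign (d : ℕ → ℝ) (I : DAB) : Prop :=
  ∃ V : Fin I.n → Ranking I.m,
    (Finset.univ.filter fun i => V i ≠ I.votes i).card ≤ I.K ∧
      seats d (support V I.τ) I.κ I.target ≤ I.ℓ

end Apportionment

/-! The mathematical core is an exchange argument followed by a knapsack. The target is held to `ℓ`
seats exactly if its entry `ℓ + 1` is preceded by at least `κ` entries (`seats_le_iff`). Of these,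
`ℓ` are its own; the others form a sum over the remaining parties in which each party's term depends
only on its own support and that of the target (`card_before`). Such a term grows with the party's
support and shrinks with the target's (`entriesBefore_mono`), so it is optimal to take as many votes
as possible from the target and hand them to the others. If this leaves the target below the
threshold or without votes, it gets no seat. Otherwise all moved votes come from the target, and
distributing them is a knapsack problem with one item class per party (`hasSuccessfulCampaign_iff`).

All votes are listed, so the knapsack capacity and every number passed to a comparison of `a * d j`
with `b * d i` are linear in the number `n` of votes, and the input size is at least `n`. The usual
dynamic program therefore takes polynomial time.

The rest realizes this on the machine. Loop-free code is verified by evaluation (`Prog.exec_eval`),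
loops by a countdown invariant (`Exec.countdown`), and unchanged memory by a syntactic check
(`Runs.frame`). The unknown program that comes with `d` runs in relocated, freshly zeroed memory
(`Runs.shift`, `exec_call`). If it yields fractions, they are compared by cross-multiplication,
which is affordable because `t` steps lengthen numbers by at most `t` bits (`Runs.atMost`). -/

namespace RAM

/-! ### Bounded executions -/

/-- From the state `s`, the program `p` halts within `B` steps, in a state satisfying `Q`. -/
def Exec (p : Prog) (s : State) (B : ℕ) (Q : State → Prop) : Prop :=
  ∃ s' t, Runs p s s' t ∧ t ≤ B ∧ Q s'

theorem Exec.weaken {p : Prog} {s : State} {B B' : ℕ} {Q Q' : State → Prop}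
    (h : Exec p s B Q) (hB : B ≤ B') (hQ : ∀ s', Q s' → Q' s') : Exec p s B' Q' := by
  obtain ⟨s', t, h1, h2, h3⟩ := h
  exact ⟨s', t, h1, h2.trans hB, hQ _ h3⟩

theorem Exec.seq {p q : Prog} {s : State} {B B' : ℕ} {Q R : State → Prop}
    (h : Exec p s B R) (h' : ∀ s', R s' → Exec q s' B' Q) : Exec (.seq p q) s (B + B') Q := by
  obtain ⟨s', t, h1, h2, h3⟩ := h
  obtain ⟨s'', t', h1', h2', h3'⟩ := h' s' h3
  exact ⟨s'', t + t', .seq h1 h1', by omega, h3'⟩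

theorem Exec.cond {x : ℕ} {p q : Prog} {s : State} {B : ℕ} {Q : State → Prop}
    (hp : s.var x ≠ 0 → Exec p s B Q) (hq : s.var x = 0 → Exec q s B Q) :
    Exec (.cond x p q) s (B + 1) Q := by
  by_cases h : s.var x = 0
  · obtain ⟨s', t, h1, h2, h3⟩ := hq h
    exact ⟨s', t + 1, .cond_false h h1, by omega, h3⟩
  · obtain ⟨s', t, h1, h2, h3⟩ := hp h
    exact ⟨s', t + 1, .cond_true h h1, by omega, h3⟩

/-! ### Loop-free programs -/

/-- The effect of a loop-free program. -/
def Prog.eval : Prog → State → State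
  | .const x c, s => s.setVar x c
  | .plus x y z, s => s.setVar x (s.var y + s.var z)
  | .minus x y z, s => s.setVar x (s.var y - s.var z)
  | .half x y, s => s.setVar x (s.var y / 2)
  | .load x a y, s => s.setVar x (s.arr a (s.var y))
  | .store a x y, s => s.setArr a (Function.update (s.arr a) (s.var x) (s.var y))
  | .clear a, s => s.setArr a fun _ => 0
  | .seq p q, s => q.eval (p.eval s)
  | .cond x p q, s => if s.var x = 0 then q.eval s else p.eval s
  | .loop _ _, s => s

/-- A bound for the number of steps of a loop-free program. -/
def Prog.cost : Prog → ℕ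
  | .seq p q => p.cost + q.cost
  | .cond _ p q => p.cost + q.cost + 1
  | _ => 1

/-- The program contains no loop. -/
def Prog.loopFree : Prog → Bool
  | .seq p q => p.loopFree && q.loopFree
  | .cond _ p q => p.loopFree && q.loopFree
  | .loop _ _ => false
  | _ => true

/-- This turns straight-line code into a function, so that its correctness becomes a computation by
`simp`. The cost adds up both branches of a test, hence it is only an upper bound. -/
theorem Prog.exec_eval (p : Prog) (hp : p.loopFree = true) (s : State) :
    Exec p s p.cost fun s' => s' = p.eval s := by
  induction p generalizing s with
  | const x c => exact ⟨_, _, .const x c s, le_rfl, rfl⟩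
  | plus x y z => exact ⟨_, _, .plus x y z s, le_rfl, rfl⟩
  | minus x y z => exact ⟨_, _, .minus x y z s, le_rfl, rfl⟩
  | half x y => exact ⟨_, _, .half x y s, le_rfl, rfl⟩
  | load x a y => exact ⟨_, _, .load x a y s, le_rfl, rfl⟩
  | store a x y => exact ⟨_, _, .store a x y s, le_rfl, rfl⟩
  | clear a => exact ⟨_, _, .clear a s, le_rfl, rfl⟩
  | seq p q ihp ihq =>
    simp only [Prog.loopFree, Bool.and_eq_true] at hp
    exact (ihp hp.1 s).seq fun s' hs' => hs' ▸ ihq hp.2 _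
  | cond x p q ihp ihq =>
    simp only [Prog.loopFree, Bool.and_eq_true] at hp
    refine Exec.cond (fun h => (ihp hp.1 s).weaken (by omega) ?_)
      (fun h => (ihq hp.2 s).weaken (by omega) ?_)
    · intro s' hs'
      simp [Prog.eval, h, hs']
    · intro s' hs'
      simp [Prog.eval, h, hs']
  | loop x p => simp [Prog.loopFree] at hp

theorem Exec.of_eval {p : Prog} (hp : p.loopFree = true) {s : State} {Q : State → Prop}
    (h : Q (p.eval s)) : Exec p s p.cost Q :=
  (p.exec_eval hp s).weaken le_rfl fun _ hs' => hs' ▸ h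

theorem Exec.eval_seq {p q : Prog} (hp : p.loopFree = true) {s : State} {B : ℕ}
    {Q : State → Prop} (h : Exec q (p.eval s) B Q) : Exec (.seq p q) s (p.cost + B) Q :=
  (p.exec_eval hp s).seq fun _ hs' => hs' ▸ h

@[simp] theorem State.var_setVar (s : State) (x v y : ℕ) :
    (s.setVar x v).var y = if y = x then v else s.var y := by
  simp [State.setVar, Function.update_apply]

@[simp] theorem State.arr_setVar (s : State) (x v : ℕ) : (s.setVar x v).arr = s.arr := rfl

@[simp] theorem State.var_setArr (s : State) (a : ℕ) (f : ℕ → ℕ) :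
    (s.setArr a f).var = s.var := rfl

@[simp] theorem State.arr_setArr (s : State) (a : ℕ) (f : ℕ → ℕ) (b : ℕ) :
    (s.setArr a f).arr b = if b = a then f else s.arr b := by
  simp [State.setArr, Function.update_apply]

@[simp] theorem State.var_ite (c : Prop) [Decidable c] (s s' : State) (x : ℕ) :
    (if c then s else s').var x = if c then s.var x else s'.var x := by
  split_ifs <;> rfl

@[simp] theorem State.arr_ite (c : Prop) [Decidable c] (s s' : State) (a : ℕ) :
    (if c then s else s').arr a = if c then s.arr a else s'.arr a := by
  split_ifs <;> rfl

/-! ### Unchanged memory -/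

/-- The program does not assign to the variable `v`. -/
def Prog.keepsVar (v : ℕ) : Prog → Bool
  | .const x _ => x != v
  | .plus x _ _ => x != v
  | .minus x _ _ => x != v
  | .half x _ => x != v
  | .load x _ _ => x != v
  | .seq p q => p.keepsVar v && q.keepsVar v
  | .cond _ p q => p.keepsVar v && q.keepsVar v
  | .loop _ p => p.keepsVar v
  | _ => true

/-- The program does not write to the array `b`. -/
def Prog.keepsArr (b : ℕ) : Prog → Bool
  | .store a _ _ => a != b
  | .clear a => a != b
  | .seq p q => p.keepsArr b && q.keepsArr b
  | .cond _ p q => p.keepsArr b && q.keepsArr b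
  | .loop _ p => p.keepsArr b
  | _ => true

/-- The memory to which `p` does not write is the same in both states. -/
def Frame (p : Prog) (s' s : State) : Prop :=
  (∀ x, p.keepsVar x = true → s'.var x = s.var x) ∧
    ∀ b, p.keepsArr b = true → s'.arr b = s.arr b

theorem Frame.refl (p : Prog) (s : State) : Frame p s s := ⟨fun _ _ => rfl, fun _ _ => rfl⟩

theorem Frame.trans {p : Prog} {s s' s'' : State} (h : Frame p s'' s') (h' : Frame p s' s) :
    Frame p s'' s :=
  ⟨fun x hx => (h.1 x hx).trans (h'.1 x hx), fun b hb => (h.2 b hb).trans (h'.2 b hb)⟩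

theorem Frame.of_keeps {p q : Prog} {s s' : State} (h : Frame p s' s)
    (hv : ∀ x, q.keepsVar x = true → p.keepsVar x = true)
    (ha : ∀ b, q.keepsArr b = true → p.keepsArr b = true) : Frame q s' s :=
  ⟨fun x hx => h.1 x (hv x hx), fun b hb => h.2 b (ha b hb)⟩

theorem frame_setVar {p : Prog} {x : ℕ} (hx : ∀ y, p.keepsVar y = true → x ≠ y) (s : State)
    (c : ℕ) : Frame p (s.setVar x c) s :=
  ⟨fun y hy => by simp [(hx y hy).symm], fun _ _ => rfl⟩

theorem frame_setArr {p : Prog} {a : ℕ} (ha : ∀ b, p.keepsArr b = true → a ≠ b) (s : State)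
    (f : ℕ → ℕ) : Frame p (s.setArr a f) s :=
  ⟨fun _ _ => rfl, fun b hb => by simp [(ha b hb).symm]⟩

/-- A syntactic check of the assigned names bounds what a run can change, so loop invariants need to
mention only the memory that is modified. -/
theorem Runs.frame {p : Prog} {s s' : State} {t : ℕ} (h : Runs p s s' t) : Frame p s' s := by
  induction h with
  | const | plus | minus | half | load => exact frame_setVar (by simp [Prog.keepsVar]) ..
  | store | clear => exact frame_setArr (by simp [Prog.keepsArr]) ..
  | seq h h' ih ih' =>
    exact (ih'.of_keeps (by simp +contextual [Prog.keepsVar])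
      (by simp +contextual [Prog.keepsArr])).trans (ih.of_keeps
        (by simp +contextual [Prog.keepsVar]) (by simp +contextual [Prog.keepsArr]))
  | cond_true h h' ih | cond_false h h' ih =>
    exact ih.of_keeps (by simp +contextual [Prog.keepsVar]) (by simp +contextual [Prog.keepsArr])
  | loop_true h h' h'' ih ih' =>
    exact ih'.trans (ih.of_keeps (by simp [Prog.keepsVar]) (by simp [Prog.keepsArr]))
  | loop_false h => exact Frame.refl ..

theorem Exec.frame {p : Prog} {s : State} {B : ℕ} {Q : State → Prop} (h : Exec p s B Q) :
    Exec p s B fun s' => Q s' ∧ Frame p s' s := by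
  obtain ⟨s', t, h1, h2, h3⟩ := h
  exact ⟨s', t, h1, h2, h3, h1.frame⟩

theorem Prog.frame_eval {p : Prog} (hp : p.loopFree = true) (s : State) :
    Frame p (p.eval s) s := by
  obtain ⟨s', t, h1, h2, rfl⟩ := p.exec_eval hp s
  exact h1.frame

/-- A loop whose variable counts down to zero. -/
theorem Exec.countdown {x : ℕ} {p : Prog} {B : ℕ} (Inv : ℕ → State → Prop) (N : ℕ) (s : State)
    (hs : s.var x = N) (hI : Inv N s)
    (step : ∀ r < N, ∀ s', s'.var x = r + 1 → Inv (r + 1) s' → Frame p s' s →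
      Exec p s' B fun s'' => s''.var x = r ∧ Inv r s'') :
    Exec (.loop x p) s (N * (B + 1) + 1) (Inv 0) := by
  -- The current state varies in the induction, whereas the frame condition stays relative to the
  -- state `s` before the loop.
  suffices ∀ s', s'.var x = N → Inv N s' → Frame p s' s →
      Exec (.loop x p) s' (N * (B + 1) + 1) (Inv 0) from this s hs hI (Frame.refl ..)
  clear hs hI
  induction N with
  | zero => exact fun s' hs hI _ => ⟨s', 1, .loop_false hs, by omega, hI⟩
  | succ N ih =>
    intro s₁ hs hI hF
    obtain ⟨s₂, t, h1, h2, h3, h4⟩ := step N (Nat.lt_succ_self N) s₁ hs hI hF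
    obtain ⟨s₃, t', h1', h2', h3'⟩ :=
      ih (fun r hr => step r (hr.trans (Nat.lt_succ_self N))) s₂ h3 h4 (h1.frame.trans hF)
    refine ⟨s₃, t + t' + 1, .loop_true (by omega) h1 h1', ?_, h3'⟩
    rw [Nat.add_mul]
    omega

/-! ### Relocated subroutines -/

/-- A bound exceeding all names of variables and arrays of a program. -/
def Prog.bound : Prog → ℕ
  | .const x _ => x + 1
  | .plus x y z => x + y + z + 1
  | .minus x y z => x + y + z + 1
  | .half x y => x + y + 1
  | .load x a y => x + a + y + 1
  | .store a x y => x + a + y + 1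
  | .clear a => a + 1
  | .seq p q => p.bound + q.bound
  | .cond x p q => x + p.bound + q.bound + 1
  | .loop x p => x + p.bound + 1

/-- The program with all variables renamed by adding `v`, and all arrays by adding `a`. -/
def Prog.shift (v a : ℕ) : Prog → Prog
  | .const x c => .const (v + x) c
  | .plus x y z => .plus (v + x) (v + y) (v + z)
  | .minus x y z => .minus (v + x) (v + y) (v + z)
  | .half x y => .half (v + x) (v + y)
  | .load x b y => .load (v + x) (a + b) (v + y)
  | .store b x y => .store (a + b) (v + x) (v + y)
  | .clear b => .clear (a + b)
  | .seq p q => .seq (p.shift v a) (q.shift v a)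
  | .cond x p q => .cond (v + x) (p.shift v a) (q.shift v a)
  | .loop x p => .loop (v + x) (p.shift v a)

/-- The state `u` contains the first `N` variables and arrays of `s`, relocated by `v` and `a`. -/
def Contains (v a N : ℕ) (u s : State) : Prop :=
  (∀ x < N, u.var (v + x) = s.var x) ∧ ∀ b < N, u.arr (a + b) = s.arr b

theorem Contains.setVar {v a N : ℕ} {u s : State} (h : Contains v a N u s) (x c : ℕ) :
    Contains v a N (u.setVar (v + x) c) (s.setVar x c) :=
  ⟨fun y hy => by simp [h.1 y hy], fun b hb => by simp [h.2 b hb]⟩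

theorem Contains.setArr {v a N : ℕ} {u s : State} (h : Contains v a N u s) (b : ℕ) (f : ℕ → ℕ) :
    Contains v a N (u.setArr (a + b) f) (s.setArr b f) :=
  ⟨fun y hy => by simp [h.1 y hy], fun b hb => by simp [h.2 b hb]⟩

theorem keepsVar_shift {v a x : ℕ} (hx : x < v) (p : Prog) :
    (p.shift v a).keepsVar x = true := by
  induction p <;> simp_all [Prog.shift, Prog.keepsVar] <;> omega

theorem keepsArr_shift {v a b : ℕ} (hb : b < a) (p : Prog) :
    (p.shift v a).keepsArr b = true := by
  induction p <;> simp_all [Prog.shift, Prog.keepsArr] <;> omega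

/-- A lockstep simulation: every name that `p` reads or writes lies below `p.bound`, so agreement on
the first `N` names is preserved and the step count does not change. -/
theorem Runs.shift {v a N : ℕ} {p : Prog} {s s' : State} {t : ℕ} (h : Runs p s s' t) :
    p.bound ≤ N → ∀ u, Contains v a N u s →
      ∃ u', Runs (p.shift v a) u u' t ∧ Contains v a N u' s' := by
  induction h with
  | const x c s =>
    exact fun hN u hu => ⟨_, .const _ c u, hu.setVar x c⟩
  | plus x y z s =>
    intro hN u hu
    simp only [Prog.bound] at hN
    refine ⟨_, .plus _ _ _ u, ?_⟩
    rw [hu.1 y (by omega), hu.1 z (by omega)]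
    exact hu.setVar ..
  | minus x y z s =>
    intro hN u hu
    simp only [Prog.bound] at hN
    refine ⟨_, .minus _ _ _ u, ?_⟩
    rw [hu.1 y (by omega), hu.1 z (by omega)]
    exact hu.setVar ..
  | half x y s =>
    intro hN u hu
    simp only [Prog.bound] at hN
    refine ⟨_, .half _ _ u, ?_⟩
    rw [hu.1 y (by omega)]
    exact hu.setVar ..
  | load x b y s =>
    intro hN u hu
    simp only [Prog.bound] at hN
    refine ⟨_, .load _ _ _ u, ?_⟩
    rw [hu.1 y (by omega), hu.2 b (by omega)]
    exact hu.setVar ..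
  | store b x y s =>
    intro hN u hu
    simp only [Prog.bound] at hN
    refine ⟨_, .store _ _ _ u, ?_⟩
    rw [hu.1 y (by omega), hu.1 x (by omega), hu.2 b (by omega)]
    exact hu.setArr ..
  | clear b s =>
    exact fun hN u hu => ⟨_, .clear _ u, hu.setArr ..⟩
  | seq h h' ih ih' =>
    intro hN u hu
    simp only [Prog.bound] at hN
    obtain ⟨u', h1, h2⟩ := ih (by omega) u hu
    obtain ⟨u'', h1', h2'⟩ := ih' (by omega) u' h2
    exact ⟨u'', .seq h1 h1', h2'⟩
  | @cond_true x p q s s' t hx h ih =>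
    intro hN u hu
    simp only [Prog.bound] at hN
    obtain ⟨u', h1, h2⟩ := ih (by omega) u hu
    exact ⟨u', .cond_true (by rwa [hu.1 x (by omega)]) h1, h2⟩
  | @cond_false x p q s s' t hx h ih =>
    intro hN u hu
    simp only [Prog.bound] at hN
    obtain ⟨u', h1, h2⟩ := ih (by omega) u hu
    exact ⟨u', .cond_false (by rwa [hu.1 x (by omega)]) h1, h2⟩
  | @loop_true x p s s' s'' t t' hx h h' ih ih' =>
    intro hN u hu
    have hN' := hN
    simp only [Prog.bound] at hN
    obtain ⟨u', h1, h2⟩ := ih (by omega) u hu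
    obtain ⟨u'', h1', h2'⟩ := ih' hN' u' h2
    exact ⟨u'', .loop_true (by rwa [hu.1 x (by omega)]) h1 h1', h2'⟩
  | @loop_false x p s hx =>
    intro hN u hu
    simp only [Prog.bound] at hN
    exact ⟨u, .loop_false (by rwa [hu.1 x (by omega)]), hu⟩

/-- Sets `N` variables, beginning with `v`, and `N` arrays, beginning with `a`, to zero. -/
def reset (v a : ℕ) : ℕ → Prog
  -- There is no empty instruction; clearing `a` takes its place.
  | 0 => .clear a
  | N + 1 => .seq (reset v a N) (.seq (.const (v + N) 0) (.clear (a + N)))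

theorem loopFree_reset (v a N : ℕ) : (reset v a N).loopFree = true := by
  induction N with
  | zero => rfl
  | succ N ih => simp [reset, Prog.loopFree, ih]

theorem keepsVar_reset {v x : ℕ} (hx : x < v) (a N : ℕ) :
    (reset v a N).keepsVar x = true := by
  induction N with
  | zero => rfl
  | succ N ih =>
    simp [reset, Prog.keepsVar, ih]
    omega

theorem keepsArr_reset {a b : ℕ} (hb : b < a) (v N : ℕ) :
    (reset v a N).keepsArr b = true := by
  induction N with
  | zero =>
    simp [reset, Prog.keepsArr]
    omega
  | succ N ih =>
    simp [reset, Prog.keepsArr, ih]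
    omega

theorem contains_eval_reset (v a N : ℕ) (s : State) :
    Contains v a N ((reset v a N).eval s) ⟨fun _ => 0, fun _ _ => 0⟩ := by
  induction N with
  | zero => exact ⟨by simp, by simp⟩
  | succ N ih =>
    simp only [reset, Prog.eval]
    refine ⟨fun x hx => ?_, fun b hb => ?_⟩
    · rcases Nat.lt_succ_iff_lt_or_eq.1 hx with h | h
      · simpa [h.ne] using ih.1 x h
      · simp [h]
    · rcases Nat.lt_succ_iff_lt_or_eq.1 hb with h | h
      · simpa [h.ne] using ih.2 b h
      · simp [h]

/-! ### Growth of the values -/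

/-- The sum of the constants of a program. -/
def Prog.consts : Prog → ℕ
  | .const _ c => c
  | .seq p q => p.consts + q.consts
  | .cond _ p q => p.consts + q.consts
  | .loop _ p => p.consts
  | _ => 0

/-- All values of the state are at most `M`. -/
def State.AtMost (s : State) (M : ℕ) : Prop := (∀ x, s.var x ≤ M) ∧ ∀ a i, s.arr a i ≤ M

theorem State.AtMost.mono {s : State} {M M' : ℕ} (h : s.AtMost M) (hM : M ≤ M') : s.AtMost M' :=
  ⟨fun x => (h.1 x).trans hM, fun a i => (h.2 a i).trans hM⟩

theorem State.AtMost.setVar {s : State} {M c : ℕ} (h : s.AtMost M) (hc : c ≤ M) (x : ℕ) :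
    (s.setVar x c).AtMost M := by
  refine ⟨fun y => ?_, h.2⟩
  rw [State.var_setVar]
  split_ifs
  exacts [hc, h.1 y]

theorem State.AtMost.setArr {s : State} {M : ℕ} {f : ℕ → ℕ} (h : s.AtMost M) (hf : ∀ i, f i ≤ M)
    (a : ℕ) : (s.setArr a f).AtMost M := by
  refine ⟨h.1, fun b i => ?_⟩
  rw [State.arr_setArr]
  split_ifs
  exacts [hf i, h.2 b i]

/-- Only addition makes values grow, and it at most doubles the maximum. The bound `M` must also
cover the constants that the program can write. -/
theorem Runs.atMost {p : Prog} {s s' : State} {t : ℕ} (h : Runs p s s' t) :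
    ∀ M, p.consts ≤ M → s.AtMost M → s'.AtMost (M * 2 ^ t) := by
  induction h with
  | const x c s =>
    exact fun M hM hs => (hs.mono (by omega)).setVar (by simp only [Prog.consts] at hM; omega) x
  | plus x y z s =>
    exact fun M hM hs => (hs.mono (by omega)).setVar (by linarith [hs.1 y, hs.1 z]) x
  | minus x y z s =>
    exact fun M hM hs => (hs.mono (by omega)).setVar (by have := hs.1 y; omega) x
  | half x y s =>
    exact fun M hM hs => (hs.mono (by omega)).setVar (by have := hs.1 y; omega) x
  | load x a y s =>
    exact fun M hM hs => (hs.mono (by omega)).setVar (by have := hs.2 a (s.var y); omega) x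
  | store a x y s =>
    refine fun M hM hs => (hs.mono (by omega)).setArr (fun i => ?_) a
    rw [Function.update_apply]
    have := hs.1 y
    have := hs.2 a i
    split_ifs <;> omega
  | clear a s => exact fun M hM hs => (hs.mono (by omega)).setArr (by simp) a
  | @seq p q s s' s'' t t' h h' ih ih' =>
    intro M hM hs
    simp only [Prog.consts] at hM
    rw [pow_add, ← mul_assoc]
    exact ih' _ (le_trans (by omega) (Nat.le_mul_of_pos_right M (by positivity)))
      (ih M (by omega) hs)
  | cond_true hx h ih =>
    intro M hM hs
    simp only [Prog.consts] at hM
    exact (ih M (by omega) hs).mono (by gcongr <;> omega)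
  | cond_false hx h ih =>
    intro M hM hs
    simp only [Prog.consts] at hM
    exact (ih M (by omega) hs).mono (by gcongr <;> omega)
  | @loop_true x p s s' s'' t t' hx h h' ih ih' =>
    intro M hM hs
    have := ih' _ (hM.trans (Nat.le_mul_of_pos_right M (by positivity : 0 < 2 ^ t)))
      (ih M hM hs)
    refine this.mono ?_
    rw [mul_assoc, ← pow_add]
    exact Nat.mul_le_mul_left M (Nat.pow_le_pow_right two_pos (by omega))
  | loop_false hx => exact fun M hM hs => hs.mono (by omega)

end RAM

/-! ### Subroutine calls and multiplication -/

namespace RAM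

theorem eval_le_eval (T : Polynomial ℕ) {a b : ℕ} (h : a ≤ b) : T.eval a ≤ T.eval b := by
  rw [Polynomial.eval_eq_sum, Polynomial.eval_eq_sum]
  exact Finset.sum_le_sum fun i _ => Nat.mul_le_mul_left _ (Nat.pow_le_pow_left h i)

/-- Runs the program `p` on separate memory, after the preparation `init`. -/
def call (p init : Prog) : Prog :=
  .seq (reset 30 10 (p.bound + 2)) (.seq init (p.shift 30 10))

/-- The caller keeps its lasting data in variables below `30` and arrays below `10`. After the
reset, the callee's memory is zero, and `init` only has to write the input there. -/
theorem exec_call {p init : Prog} {w : List ℕ} {s' : State} {t : ℕ} (h : Runs p (start w) s' t)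
    (hi : init.loopFree = true) (u : State)
    (hu : ∀ u', Contains 30 10 (p.bound + 2) u' ⟨fun _ => 0, fun _ _ => 0⟩ →
      (∀ x < 30, u'.var x = u.var x) → Contains 30 10 (p.bound + 2) (init.eval u') (start w)) :
    Exec (call p init) u ((reset 30 10 (p.bound + 2)).cost + (init.cost + t)) fun u' =>
      u'.var 30 = s'.var 0 ∧ u'.var 31 = s'.var 1 := by
  refine Exec.eval_seq (loopFree_reset _ _ _) (Exec.eval_seq hi ?_)
  -- The summand `2` keeps the result variables `0` and `1` inside the relocated region even for a
  -- very small `p.bound`.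
  obtain ⟨u', h5, h6⟩ := Runs.shift h (Nat.le_add_right _ 2) _
    (hu _ (contains_eval_reset 30 10 (p.bound + 2) u)
      fun x hx => (Prog.frame_eval (loopFree_reset ..) u).1 x (keepsVar_reset hx ..))
  exact ⟨u', t, h5, le_rfl, h6.1 0 (by omega), h6.1 1 (by omega)⟩

theorem keepsVar_call {x : ℕ} (hx : x < 30) (p : Prog) {init : Prog}
    (hi : init.keepsVar x = true) : (call p init).keepsVar x = true := by
  simp [call, Prog.keepsVar, keepsVar_reset hx, keepsVar_shift hx, hi]

theorem keepsArr_call {b : ℕ} (hb : b < 10) (p : Prog) {init : Prog}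
    (hi : init.keepsArr b = true) : (call p init).keepsArr b = true := by
  simp [call, Prog.keepsArr, keepsArr_reset hb, keepsArr_shift hb, hi]

/-- Passes the variables `20`, …, `23` as arguments. -/
def passFour : Prog :=
  .seq (.store 10 31 20) (.seq (.const 31 1) (.seq (.store 10 31 21) (.seq (.const 31 2)
    (.seq (.store 10 31 22) (.seq (.const 31 3) (.seq (.store 10 31 23) (.seq (.const 31 0)
      (.const 30 4))))))))

/-- Variable `31` is the callee's variable `1`. It is zero after the reset, serves as the array
index, and is set back to zero; variable `30` receives the input length. -/
theorem contains_passFour {N : ℕ} (hN : 2 ≤ N) (u u' : State)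
    (h : Contains 30 10 N u' ⟨fun _ => 0, fun _ _ => 0⟩) (hu : ∀ x < 30, u'.var x = u.var x) :
    Contains 30 10 N (passFour.eval u')
      (start [u.var 20, u.var 21, u.var 22, u.var 23]) := by
  have h31 : u'.var 31 = 0 := h.1 1 (by omega)
  have h10 : u'.arr 10 = fun _ => 0 := h.2 0 (by omega)
  refine ⟨fun x hx => ?_, fun b hb => ?_⟩
  · have := h.1 x hx
    simp only at this
    by_cases h0 : x = 0
    · simp [passFour, Prog.eval, start, h0]
    · by_cases h1 : x = 1
      · simp [passFour, Prog.eval, start, h1]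
      · have h2 : 30 + x ≠ 31 := by omega
        simp [passFour, Prog.eval, start, h0, h2, this]
  · have := h.2 b hb
    simp only at this
    by_cases h0 : b = 0
    · funext k
      simp only [passFour, Prog.eval, start, h0, State.var_setVar, State.arr_setVar,
        State.var_setArr, State.arr_setArr, h31, h10, hu 20 (by omega), hu 21 (by omega),
        hu 22 (by omega), hu 23 (by omega)]
      rcases k with _ | _ | _ | _ | k <;> simp
    · simp [passFour, Prog.eval, start, h0, this]

/-- Passes the variable `x` as the only argument. -/
def passOne (x : ℕ) : Prog := .seq (.store 10 31 x) (.const 30 1)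

theorem contains_passOne {N x : ℕ} (hN : 2 ≤ N) (hx : x < 30) (u u' : State)
    (h : Contains 30 10 N u' ⟨fun _ => 0, fun _ _ => 0⟩) (hu : ∀ x < 30, u'.var x = u.var x) :
    Contains 30 10 N ((passOne x).eval u') (start [u.var x]) := by
  have h31 : u'.var 31 = 0 := h.1 1 (by omega)
  have h10 : u'.arr 10 = fun _ => 0 := h.2 0 (by omega)
  refine ⟨fun y hy => ?_, fun b hb => ?_⟩
  · have := h.1 y hy
    simp only at this
    by_cases h0 : y = 0
    · simp [passOne, Prog.eval, start, h0]
    · simp [passOne, Prog.eval, start, h0, this]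
  · have := h.2 b hb
    simp only at this
    by_cases h0 : b = 0
    · funext k
      simp only [passOne, Prog.eval, start, h0, State.arr_setVar, State.arr_setArr, h31, h10,
        hu x hx]
      rcases k with _ | k <;> simp
    · simp [passOne, Prog.eval, start, h0, this]

/-- One step of the multiplication. -/
def mulStep : Prog :=
  .seq (.half 33 32) (.seq (.minus 34 32 33) (.seq (.minus 34 34 33)
    (.seq (.cond 34 (.plus 30 30 31) (.const 34 0)) (.seq (.plus 31 31 31)
      (.seq (.const 34 0) (.plus 32 33 34))))))

/-- Multiplies the variables `31` and `32`, with result in the variable `30`. -/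
def mul : Prog := .seq (.const 30 0) (.loop 32 mulStep)

/-- Binary multiplication: the sum of variable `30` and the product of `31` and `32` is invariant
when `32` is halved, `31` is doubled, and an odd bit of `32` adds `31` to `30`. There is one round
per bit of `32`. -/
theorem exec_loop_mulStep (k : ℕ) (s : State) (hk : s.var 32 < 2 ^ k) :
    Exec (.loop 32 mulStep) s (11 * k + 1) fun s' =>
      s'.var 30 = s.var 30 + s.var 31 * s.var 32 := by
  induction k generalizing s with
  | zero =>
    have h0 : s.var 32 = 0 := by omega
    exact ⟨s, 1, .loop_false h0, by omega, by simp [h0]⟩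
  | succ k ih =>
    by_cases h0 : s.var 32 = 0
    · exact ⟨s, 1, .loop_false h0, by omega, by simp [h0]⟩
    obtain ⟨s₁, t, h1, h2, h3⟩ := Prog.exec_eval mulStep rfl s
    have e32 : s₁.var 32 = s.var 32 / 2 := by
      simp [h3, mulStep, Prog.eval]
    have e31 : s₁.var 31 = s.var 31 + s.var 31 := by
      simp [h3, mulStep, Prog.eval]
    have e30 : s₁.var 30 = s.var 30 + s.var 31 * (s.var 32 % 2) := by
      rcases Nat.mod_two_eq_zero_or_one (s.var 32) with h | h
      · have : s.var 32 - s.var 32 / 2 - s.var 32 / 2 = 0 := by omega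
        simp [h3, mulStep, Prog.eval, this, h]
      · have : s.var 32 - s.var 32 / 2 - s.var 32 / 2 = 1 := by omega
        simp [h3, mulStep, Prog.eval, this, h]
    obtain ⟨s₂, t', h1', h2', h3'⟩ := ih s₁ (by rw [pow_succ] at hk; omega)
    refine ⟨s₂, _, .loop_true h0 h1 h1', ?_, ?_⟩
    · have : mulStep.cost = 9 := rfl
      omega
    · beta_reduce
      rw [h3', e30, e31, e32]
      have := Nat.div_add_mod (s.var 32) 2
      nlinarith

theorem exec_mul (k : ℕ) (s : State) (hk : s.var 32 < 2 ^ k) :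
    Exec mul s (11 * k + 2) fun s' => s'.var 30 = s.var 31 * s.var 32 := by
  refine (Exec.eval_seq rfl (exec_loop_mulStep k _ (by simpa [Prog.eval] using hk))).weaken ?_ ?_
  · simp only [Prog.cost]
    omega
  · simp [Prog.eval]

theorem atMost_start (i : ℕ) : (start [i]).AtMost (i + 1) := by
  refine ⟨fun x => ?_, fun a j => ?_⟩
  · simp only [start, Function.update_apply]
    split_ifs <;> simp
  · simp only [start, Function.update_apply]
    split_ifs
    · rcases j with _ | j <;> simp
    · simp

theorem Runs.var_lt {p : Prog} {i : ℕ} {s : State} {t : ℕ} (h : Runs p (start [i]) s t) (x : ℕ)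
    {k : ℕ} (hk : p.consts + i + 1 + t ≤ k) : s.var x < 2 ^ k :=
  calc s.var x ≤ (p.consts + i + 1) * 2 ^ t :=
        (h.atMost _ (by omega) ((atMost_start i).mono (by omega))).1 x
    _ < 2 ^ (p.consts + i + 1) * 2 ^ t := by gcongr; exact Nat.lt_two_pow_self
    _ = 2 ^ (p.consts + i + 1 + t) := (pow_add ..).symm
    _ ≤ 2 ^ k := Nat.pow_le_pow_right two_pos hk

end RAM

/-! ### Comparing multiples of divisors -/

namespace Apportionment

open RAM

/-- The program `cmp` compares `a * d j` with `b * d i`, where `a`, `b`, `i`, `j` are the variables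
`20`, …, `23`, in time given by `T`. The result is in the variable `24`. -/
structure Compares (d : ℕ → ℝ) (cmp : Prog) (T : Polynomial ℕ) : Prop where
  keepsVar : ∀ x < 20, cmp.keepsVar x = true
  keepsArr : ∀ b < 10, cmp.keepsArr b = true
  exec : ∀ s : State, 1 ≤ s.var 22 → 1 ≤ s.var 23 →
    Exec cmp s (T.eval (s.var 20 + s.var 21 + s.var 22 + s.var 23)) fun s' =>
      (s'.var 24 ≠ 0 ↔ (s.var 20 : ℝ) * d (s.var 23) ≤ (s.var 21 : ℝ) * d (s.var 22))

theorem ComparisonComputable.exists_compares {d : ℕ → ℝ} (h : ComparisonComputable d) :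
    ∃ cmp T, Compares d cmp T := by
  obtain ⟨p, T, h⟩ := h
  refine ⟨.seq (call p passFour) (.cond 30 (.const 24 1) (.const 24 0)),
    T + Polynomial.C ((reset 30 10 (p.bound + 2)).cost + passFour.cost + 4),
    fun x hx => ?_, fun b hb => ?_, fun s hi hj => ?_⟩
  · have : (call p passFour).keepsVar x = true := keepsVar_call (by omega) p (by
      simp [passFour, Prog.keepsVar]; omega)
    simp [Prog.keepsVar, this]
    omega
  · have : (call p passFour).keepsArr b = true := keepsArr_call hb p (by
      simp [passFour, Prog.keepsArr]; omega)
    simp [Prog.keepsArr, this]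
  obtain ⟨s', t, h1, h2, h3⟩ := h (s.var 20) (s.var 21) _ _ hi hj
  refine ((exec_call h1 rfl s fun u' hu hu' => contains_passFour (by omega) s u' hu hu').seq
    (Q := fun s' => (s'.var 24 ≠ 0 ↔ (s.var 20 : ℝ) * d (s.var 23) ≤
      (s.var 21 : ℝ) * d (s.var 22)))
    (fun u hu => Exec.of_eval rfl ?_)).weaken ?_ fun _ h => h
  · rw [← h3, ← hu.1]
    by_cases h0 : u.var 30 = 0 <;> simp [Prog.eval, h0]
  · simp only [Polynomial.eval_add, Polynomial.eval_C, Prog.cost]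
    omega

/-- Compares fractions, whose numerators and denominators are computed by `p`. -/
def compareFractions (p : Prog) : Prog :=
  .seq (.const 24 0) (.seq (call p (passOne 22)) (.seq (.seq (.plus 26 30 24) (.plus 27 31 24))
    (.seq (call p (passOne 23)) (.seq (.seq (.plus 29 31 24) (.seq (.plus 31 30 24)
      (.plus 32 20 24))) (.seq mul (.seq (.seq (.plus 31 30 24) (.plus 32 27 24)) (.seq mul
        (.seq (.seq (.plus 25 30 24) (.seq (.plus 31 26 24) (.plus 32 21 24))) (.seq mul
          (.seq (.seq (.plus 31 30 24) (.plus 32 29 24)) (.seq mul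
            (.seq (.minus 25 25 30) (.cond 25 (.const 24 0) (.const 24 1))))))))))))))

/-- Denominators are cleared by four multiplications. Intermediate values survive in variables below
`30`, which neither `call` nor `mul` touches. Only the factors placed in variable `32` are scanned
bit by bit, so the numerators need no size bound. -/
theorem exec_compareFractions {p : Prog} {s s₁ s₂ : State} {t₁ t₂ k : ℕ}
    (h₁ : Runs p (start [s.var 22]) s₁ t₁) (h₂ : Runs p (start [s.var 23]) s₂ t₂)
    (ha : s.var 20 < 2 ^ k) (hb : s.var 21 < 2 ^ k) (hq : s₁.var 1 < 2 ^ k)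
    (ht : s₂.var 1 < 2 ^ k) :
    Exec (compareFractions p) s
      (t₁ + t₂ + 44 * k + (2 * (reset 30 10 (p.bound + 2)).cost + 40)) fun s' =>
        (s'.var 24 ≠ 0 ↔ s.var 20 * s₂.var 0 * s₁.var 1 ≤ s₁.var 0 * s.var 21 * s₂.var 1) := by
  have hkeep : ∀ y, 20 ≤ y → y < 30 → ∀ x, (call p (passOne y)).keepsVar x = true ∨ 30 ≤ x := by
    intro y _ _ x
    by_cases hx : x < 30
    · refine .inl (keepsVar_call hx p ?_)
      simp [passOne, Prog.keepsVar]
      omega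
    · exact .inr (by omega)
  have hcost : ∀ y, (passOne y).cost = 2 := fun _ => rfl
  obtain ⟨u₀, r₀, g₀, b₀, e₀⟩ := Prog.exec_eval (.const 24 0) rfl s
  have v₀ (x : ℕ) : u₀.var x = if x = 24 then 0 else s.var x := by simp [e₀, Prog.eval]
  have e22 : u₀.var 22 = s.var 22 := by simp [v₀]
  rw [← e22] at h₁
  obtain ⟨u₁, r₁, g₁, b₁, ⟨q₁, q₁'⟩, f₁, -⟩ := (exec_call (init := passOne 22) h₁ rfl u₀
    fun u' hu hu' => contains_passOne (by omega) (by omega) u₀ u' hu hu').frame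
  have v₁ (x : ℕ) (hx : x < 30) : u₁.var x = u₀.var x :=
    f₁ x ((hkeep 22 (by omega) (by omega) x).resolve_right (by omega))
  obtain ⟨u₂, r₂, g₂, b₂, e₂⟩ :=
    Prog.exec_eval (.seq (.plus 26 30 24) (.plus 27 31 24)) rfl u₁
  have v₂ (x : ℕ) : u₂.var x = if x = 27 then s₁.var 1 else if x = 26 then s₁.var 0 else
      u₁.var x := by simp [e₂, Prog.eval, q₁, q₁', v₁, v₀]
  have e23 : u₂.var 23 = s.var 23 := by simp [v₂, v₁, v₀]
  rw [← e23] at h₂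
  obtain ⟨u₃, r₃, g₃, b₃, ⟨q₃, q₃'⟩, f₃, -⟩ := (exec_call (init := passOne 23) h₂ rfl u₂
    fun u' hu hu' => contains_passOne (by omega) (by omega) u₂ u' hu hu').frame
  have v₃ (x : ℕ) (hx : x < 30) : u₃.var x = u₂.var x :=
    f₃ x ((hkeep 23 (by omega) (by omega) x).resolve_right (by omega))
  obtain ⟨u₄, r₄, g₄, b₄, e₄⟩ := Prog.exec_eval
    (.seq (.plus 29 31 24) (.seq (.plus 31 30 24) (.plus 32 20 24))) rfl u₃
  have v₄ (x : ℕ) : u₄.var x = if x = 32 then s.var 20 else if x = 31 then s₂.var 0 else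
      if x = 29 then s₂.var 1 else u₃.var x := by
    simp [e₄, Prog.eval, q₃, q₃', v₃, v₂, v₁, v₀]
  obtain ⟨u₅, r₅, g₅, b₅, q₅, f₅, -⟩ := (exec_mul k u₄ (by simpa [v₄] using ha)).frame
  have m₅ (x : ℕ) (hx : x < 30) : u₅.var x = u₄.var x :=
    f₅ x (by simp [mul, mulStep, Prog.keepsVar]; omega)
  obtain ⟨u₆, r₆, g₆, b₆, e₆⟩ := Prog.exec_eval (.seq (.plus 31 30 24) (.plus 32 27 24)) rfl u₅
  have v₆ (x : ℕ) : u₆.var x = if x = 32 then s₁.var 1 else if x = 31 then u₅.var 30 else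
      u₅.var x := by
    simp [e₆, Prog.eval, m₅, v₄, v₃, v₂, v₁, v₀]
  obtain ⟨u₇, r₇, g₇, b₇, q₇, f₇, -⟩ := (exec_mul k u₆ (by simpa [v₆] using hq)).frame
  have m₇ (x : ℕ) (hx : x < 30) : u₇.var x = u₆.var x :=
    f₇ x (by simp [mul, mulStep, Prog.keepsVar]; omega)
  obtain ⟨u₈, r₈, g₈, b₈, e₈⟩ := Prog.exec_eval
    (.seq (.plus 25 30 24) (.seq (.plus 31 26 24) (.plus 32 21 24))) rfl u₇
  have v₈ (x : ℕ) : u₈.var x = if x = 32 then s.var 21 else if x = 31 then s₁.var 0 else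
      if x = 25 then u₇.var 30 else u₇.var x := by
    simp [e₈, Prog.eval, m₇, v₆, m₅, v₄, v₃, v₂, v₁, v₀]
  obtain ⟨u₉, r₉, g₉, b₉, q₉, f₉, -⟩ := (exec_mul k u₈ (by simpa [v₈] using hb)).frame
  have m₉ (x : ℕ) (hx : x < 30) : u₉.var x = u₈.var x :=
    f₉ x (by simp [mul, mulStep, Prog.keepsVar]; omega)
  obtain ⟨w₁, r₁', g₁', b₁', e₁'⟩ :=
    Prog.exec_eval (.seq (.plus 31 30 24) (.plus 32 29 24)) rfl u₉
  have v₁' (x : ℕ) : w₁.var x = if x = 32 then s₂.var 1 else if x = 31 then u₉.var 30 else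
      u₉.var x := by
    simp [e₁', Prog.eval, m₉, v₈, m₇, v₆, m₅, v₄, v₃, v₂, v₁, v₀]
  obtain ⟨w₂, r₂', g₂', b₂', q₂', f₂', -⟩ := (exec_mul k w₁ (by simpa [v₁'] using ht)).frame
  have m₂' (x : ℕ) (hx : x < 30) : w₂.var x = w₁.var x :=
    f₂' x (by simp [mul, mulStep, Prog.keepsVar]; omega)
  obtain ⟨w₃, r₃', g₃', b₃', e₃'⟩ :=
    Prog.exec_eval (.seq (.minus 25 25 30) (.cond 25 (.const 24 0) (.const 24 1))) rfl w₂
  refine ⟨w₃, _, .seq g₀ (.seq g₁ (.seq g₂ (.seq g₃ (.seq g₄ (.seq g₅ (.seq g₆ (.seq g₇ (.seq g₈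
    (.seq g₉ (.seq g₁' (.seq g₂' g₃'))))))))))), ?_, ?_⟩
  · simp only [Prog.cost, hcost] at *
    omega
  · have e30 : w₂.var 30 = s₁.var 0 * s.var 21 * s₂.var 1 := by simp [q₂', v₁', q₉, v₈]
    have e25 : w₂.var 25 = s.var 20 * s₂.var 0 * s₁.var 1 := by
      simp [m₂', v₁', m₉, v₈, q₇, v₆, q₅, v₄, mul_comm]
    simp [e₃', Prog.eval, e30, e25, Nat.sub_eq_zero_iff_le]

theorem FractionComputable.exists_compares {d : ℕ → ℝ} (h : FractionComputable d) :
    ∃ cmp T, Compares d cmp T := by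
  obtain ⟨p, T, h⟩ := h
  -- With `k = p.consts + 1 + S + T.eval S`, this is `44 * k` plus two calls of at most `T.eval S`
  -- steps each, plus the fixed overhead.
  refine ⟨compareFractions p, 46 * T + 44 * Polynomial.X + Polynomial.C
    (44 * (p.consts + 1) + (2 * (reset 30 10 (p.bound + 2)).cost + 40)),
    fun x hx => ?_, fun b hb => ?_, fun s hi hj => ?_⟩
  · have (y : ℕ) : (call p (passOne y)).keepsVar x = true := keepsVar_call (by omega) p (by
      simp [passOne, Prog.keepsVar]; omega)
    simp [compareFractions, Prog.keepsVar, mul, mulStep, this]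
    omega
  · have (y : ℕ) : (call p (passOne y)).keepsArr b = true := keepsArr_call hb p (by
      simp [passOne, Prog.keepsArr]; omega)
    simp [compareFractions, Prog.keepsArr, mul, mulStep, this]
  obtain ⟨s₁, t₁, h₁, b₁, n₁, d₁⟩ := h _ hi
  obtain ⟨s₂, t₂, h₂, b₂, n₂, d₂⟩ := h _ hj
  set S := s.var 20 + s.var 21 + s.var 22 + s.var 23 with hS
  replace b₁ := b₁.trans (eval_le_eval T (by omega : s.var 22 ≤ S))
  replace b₂ := b₂.trans (eval_le_eval T (by omega : s.var 23 ≤ S))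
  have hlt {x : ℕ} (hx : x ≤ S) : x < 2 ^ (p.consts + 1 + S + T.eval S) :=
    Nat.lt_two_pow_self.trans_le (Nat.pow_le_pow_right two_pos (by omega))
  refine (exec_compareFractions h₁ h₂ (hlt (by omega)) (hlt (by omega)) (h₁.var_lt 1 (by omega))
    (h₂.var_lt 1 (by omega))).weaken ?_ fun s' hs' => hs'.trans ?_
  · simp only [Polynomial.eval_add, Polynomial.eval_mul, Polynomial.eval_C, Polynomial.eval_X,
      Polynomial.eval_ofNat]
    omega
  · rw [d₁, d₂, ← mul_div_assoc, ← mul_div_assoc, div_le_div_iff₀ (by positivity) (by positivity)]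
    norm_cast
    rw [mul_comm (s₁.var 0)]

end Apportionment

namespace Apportionment

open Finset

/-! ### A criterion for the number of seats -/

theorem IsDivisorSequence.pos {d : ℕ → ℝ} (hd : IsDivisorSequence d) {i : ℕ} (hi : 1 ≤ i) :
    0 < d i := by
  rcases hi.eq_or_lt with rfl | h
  · exact one_pos.trans_le hd.one_le
  · exact one_pos.trans_le (hd.one_le.trans (hd.lt_of_lt 1 i le_rfl h).le)

open Classical in
/-- The number of the first `κ` entries of the fraction list of a party with support `c` that come
before entry `ℓ + 1` of the list of a party with support `s`, where `lt` says that the former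
party has the lower index. -/
noncomputable def entriesBefore (d : ℕ → ℝ) (κ ℓ s : ℕ) (lt : Prop) (c : ℕ) : ℕ :=
  #{j ∈ Icc 1 κ | if lt then (s : ℝ) * d j ≤ c * d (ℓ + 1) else (s : ℝ) * d j < c * d (ℓ + 1)}

/-- The divisors are positive, so each comparison survives when the target loses support or the
other party gains some. This is why votes should move from the target to the others. -/
theorem entriesBefore_mono {d : ℕ → ℝ} (hd : IsDivisorSequence d) (κ ℓ : ℕ) {s s' : ℕ}
    (lt : Prop) {c c' : ℕ} (hs : s' ≤ s) (hc : c ≤ c') :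
    entriesBefore d κ ℓ s lt c ≤ entriesBefore d κ ℓ s' lt c' := by
  refine card_le_card fun j hj => ?_
  simp only [mem_filter] at hj ⊢
  refine ⟨hj.1, ?_⟩
  have h1 : (s' : ℝ) * d j ≤ s * d j := by
    have := hd.pos (mem_Icc.1 hj.1).1
    gcongr
  have h2 : (c : ℝ) * d (ℓ + 1) ≤ c' * d (ℓ + 1) := by
    have := hd.pos (Nat.le_add_left 1 ℓ)
    gcongr
  by_cases h : lt
  · simp only [h, if_true] at hj ⊢
    exact h1.trans (hj.2.trans h2)
  · simp only [h, if_false] at hj ⊢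
    exact h1.trans_lt (hj.2.trans_le h2)

theorem entriesBefore_zero {d : ℕ → ℝ} (hd : IsDivisorSequence d) (κ ℓ : ℕ) {s : ℕ} (hs : 0 < s)
    (lt : Prop) : entriesBefore d κ ℓ s lt 0 = 0 := by
  rw [entriesBefore, card_eq_zero, filter_eq_empty_iff]
  intro j hj
  have h1 := hd.pos (mem_Icc.1 hj).1
  have h2 : 0 < (s : ℝ) * d j := by positivity
  split_ifs <;> simp <;> linarith

theorem before_iff {d : ℕ → ℝ} (hd : IsDivisorSequence d) {m : ℕ} (σ : Fin m → ℕ) {P Q : Fin m}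
    (hQ : Q ≠ P) {j k : ℕ} (hj : 1 ≤ j) (hk : 1 ≤ k) :
    Before d σ (Q, j) (P, k) ↔
      if Q < P then (σ P : ℝ) * d j ≤ σ Q * d k else (σ P : ℝ) * d j < σ Q * d k := by
  have h1 := hd.pos hj
  have h2 := hd.pos hk
  simp only [Before, hQ, false_and, or_false]
  rw [div_lt_div_iff₀ h2 h1, div_eq_div_iff h1.ne' h2.ne', eq_comm]
  split_ifs with h
  · simp only [h, and_true]
    exact le_iff_lt_or_eq.symm
  · simp [h]

theorem before_self_iff {d : ℕ → ℝ} (hd : IsDivisorSequence d) {m : ℕ} (σ : Fin m → ℕ)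
    {P : Fin m} (hP : 0 < σ P) {j k : ℕ} (hj : 1 ≤ j) (hk : 1 ≤ k) :
    Before d σ (P, j) (P, k) ↔ j < k := by
  have h1 := hd.pos hj
  have h2 := hd.pos hk
  have h3 : (0 : ℝ) < σ P := by exact_mod_cast hP
  simp only [Before, lt_self_iff_false, true_and, false_or]
  rw [div_lt_div_iff_of_pos_left h3 h2 h1]
  constructor
  · rintro (h | h)
    · by_contra! h'
      rcases h'.eq_or_lt with rfl | h'
      · exact h.false
      · exact (h.trans (hd.lt_of_lt k j hk h')).false
    · exact h.2
  · exact fun h => .inl (hd.lt_of_lt j k hj h)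

open Classical in
-- Counting party by party: the target's own list contributes its first `ℓ` entries because the
-- divisors increase. The remaining parties contribute independently, which makes the optimization a
-- knapsack.
theorem card_before {d : ℕ → ℝ} (hd : IsDivisorSequence d) {m : ℕ} (σ : Fin m → ℕ)
    {P : Fin m} (hP : 0 < σ P) {κ ℓ : ℕ} (hℓ : ℓ ≤ κ) :
    #{y ∈ (univ : Finset (Fin m)) ×ˢ Icc 1 κ | Before d σ y (P, ℓ + 1)} =
      ℓ + ∑ Q ∈ univ.erase P, entriesBefore d κ ℓ (σ P) (Q < P) (σ Q) := by
  rw [card_filter, sum_product, ← add_sum_erase _ _ (mem_univ P)]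
  congr 1
  · rw [← card_filter, show ({j ∈ Icc 1 κ | Before d σ (P, j) (P, ℓ + 1)} : Finset ℕ) = Icc 1 ℓ from
      ?_, Nat.card_Icc, Nat.add_sub_cancel]
    ext j
    simp only [mem_filter, mem_Icc]
    constructor
    · rintro ⟨h1, h2⟩
      rw [before_self_iff hd σ hP h1.1 (by omega)] at h2
      omega
    · intro h
      rw [before_self_iff hd σ hP h.1 (by omega)]
      omega
  · refine sum_congr rfl fun Q hQ => ?_
    rw [← card_filter, entriesBefore]
    congr 1
    ext j
    simp only [mem_filter]
    refine and_congr_right fun hj => ?_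
    convert before_iff hd σ (ne_of_mem_erase hQ) (mem_Icc.1 hj).1 (Nat.le_add_left 1 ℓ)

theorem before_mono {d : ℕ → ℝ} (hd : IsDivisorSequence d) {m : ℕ} (σ : Fin m → ℕ)
    {P : Fin m} (hP : 0 < σ P) {y : Fin m × ℕ} {j k : ℕ} (hj : 1 ≤ j) (hjk : j < k)
    (h : Before d σ y (P, j)) : Before d σ y (P, k) := by
  have h3 : (0 : ℝ) < σ P := by exact_mod_cast hP
  have h1 : (σ P : ℝ) / d k < σ P / d j :=
    div_lt_div_of_pos_left h3 (hd.pos hj) (hd.lt_of_lt j k hj hjk)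
  rcases h with h | h
  · exact .inl (h1.trans h)
  · exact .inl (h1.trans_eq h.1.symm)

/-- By `before_mono`, the winning entries of `P` form an initial segment of its list. For `ℓ < κ`,
the bound on the seats thus says that entry `ℓ + 1` does not win. -/
theorem seats_le_iff {d : ℕ → ℝ} (hd : IsDivisorSequence d) {m : ℕ} (σ : Fin m → ℕ)
    {P : Fin m} (hP : 0 < σ P) {κ ℓ : ℕ} (hℓ : ℓ ≤ κ) :
    seats d σ κ P ≤ ℓ ↔
      κ ≤ ℓ + ∑ Q ∈ univ.erase P, entriesBefore d κ ℓ (σ P) (Q < P) (σ Q) := by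
  classical
  rw [← card_before hd σ hP hℓ]
  -- If `ℓ = κ`, entry `ℓ + 1` is not on the list at all, but both sides hold trivially.
  rcases hℓ.eq_or_lt with rfl | hlt
  · refine iff_of_true ((card_filter_le _ _).trans (by simp)) ?_
    rw [card_before hd σ hP le_rfl]
    exact Nat.le_add_right _ _
  simp only [seats, hP, true_and]
  constructor
  · intro h
    by_contra! hr
    have : Icc 1 (ℓ + 1) ⊆ {j ∈ Icc 1 κ | #{y ∈ (univ : Finset (Fin m)) ×ˢ Icc 1 κ |
        Before d σ y (P, j)} < κ} := by
      intro j hj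
      rw [mem_Icc] at hj
      rw [mem_filter, mem_Icc]
      refine ⟨by omega, lt_of_le_of_lt (card_le_card fun y hy => ?_) hr⟩
      rw [mem_filter] at hy ⊢
      refine ⟨hy.1, ?_⟩
      rcases hj.2.eq_or_lt with rfl | h'
      · exact hy.2
      · exact before_mono hd σ hP hj.1 h' hy.2
    have := card_le_card this
    rw [Nat.card_Icc] at this
    omega
  · intro h
    have : ({j ∈ Icc 1 κ | #{y ∈ (univ : Finset (Fin m)) ×ˢ Icc 1 κ |
        Before d σ y (P, j)} < κ} : Finset ℕ) ⊆ Icc 1 ℓ := by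
      intro j hj
      rw [mem_filter, mem_Icc] at hj
      rw [mem_Icc]
      refine ⟨hj.1.1, ?_⟩
      by_contra! h'
      refine (hj.2.trans_le (h.trans (card_le_card fun y hy => ?_))).false
      rw [mem_filter] at hy ⊢
      refine ⟨hy.1, ?_⟩
      rcases (Nat.succ_le_of_lt h').eq_or_lt with rfl | h''
      · exact hy.2
      · exact before_mono hd σ hP (by omega) h'' hy.2
    simpa using card_le_card this

/-! ### Moving votes -/

open Classical in
/-- The votes that differ. -/
noncomputable def changed {m n : ℕ} (V W : Fin n → Ranking m) : Finset (Fin n) :=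
  {i | V i ≠ W i}

theorem isTop_iff {m : ℕ} (hm : 0 < m) (r : Ranking m) (P : Fin m) :
    IsTop r P ↔ r ⟨0, hm⟩ = P := by
  rw [IsTop, ← Equiv.eq_symm_apply, Fin.ext_iff]
  exact eq_comm

theorem topCount_eq {m n : ℕ} (hm : 0 < m) (V : Fin n → Ranking m) (P : Fin m) :
    topCount V P = #{i | V i ⟨0, hm⟩ = P} := by
  classical
  simp only [topCount, isTop_iff hm]

theorem topCount_le_add_changed {m n : ℕ} (V W : Fin n → Ranking m) (P : Fin m) :
    topCount W P ≤ topCount V P + #(changed V W) := by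
  classical
  rw [topCount_eq P.pos, topCount_eq P.pos]
  refine (card_le_card fun i hi => ?_).trans (card_union_le _ _)
  simp only [mem_filter, mem_univ, true_and, mem_union, changed] at hi ⊢
  by_cases h : V i = W i
  · exact .inl (h ▸ hi)
  · exact .inr h

/-- A vote gained by `P` is a changed vote whose new top choice is `P`. For different parties these
votes are disjoint, so the gains together stay within the number of changes. -/
theorem topCount_le_add_changed_filter {m n : ℕ} (V W : Fin n → Ranking m) (P : Fin m) :
    topCount V P ≤ topCount W P + #{i ∈ changed V W | V i ⟨0, P.pos⟩ = P} := by
  classical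
  rw [topCount_eq P.pos, topCount_eq P.pos]
  refine (card_le_card fun i hi => ?_).trans (card_union_le _ _)
  simp only [mem_filter, mem_univ, true_and, mem_union, changed] at hi ⊢
  by_cases h : V i = W i
  · exact .inl (h ▸ hi)
  · exact .inr ⟨h, hi⟩

theorem exists_move_one {m n : ℕ} (V : Fin n → Ranking m) {P Q : Fin m} (hQ : Q ≠ P)
    (hP : 0 < topCount V P) : ∃ W, #(changed W V) ≤ 1 ∧ topCount W P + 1 = topCount V P ∧
      topCount W Q = topCount V Q + 1 ∧ ∀ R, R ≠ P → topCount V R ≤ topCount W R := by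
  classical
  rw [topCount_eq P.pos, card_pos] at hP
  obtain ⟨i, hi⟩ := hP
  simp only [mem_filter, mem_univ, true_and] at hi
  -- Only the top choice matters; this transposition is one ranking that puts `Q` first.
  let W : Fin n → Ranking m := Function.update V i (Equiv.swap ⟨0, P.pos⟩ Q)
  have hWi : W i ⟨0, P.pos⟩ = Q := by simp [W]
  have hW : ∀ k, k ≠ i → W k = V k := fun k hk => by simp [W, hk]
  refine ⟨W, ?_, ?_, ?_, ?_⟩
  · refine (card_le_card (t := {i}) fun k hk => ?_).trans (by simp)
    by_contra h
    simp only [changed, mem_filter, mem_univ, true_and] at hk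
    exact hk (hW k (by simpa using h))
  · simp only [topCount_eq P.pos]
    rw [← card_erase_add_one (s := {k | V k ⟨0, P.pos⟩ = P}) (a := i) (by simpa using hi)]
    congr 2
    ext k
    simp only [mem_filter, mem_univ, true_and, mem_erase]
    by_cases hk : k = i
    · subst hk
      simp [hWi, hQ]
    · simp [hk, hW]
  · simp only [topCount_eq P.pos]
    rw [← card_insert_of_notMem (s := {k | V k ⟨0, P.pos⟩ = Q}) (a := i) (by simp [hi, hQ.symm])]
    congr 1
    ext k
    simp only [mem_filter, mem_univ, true_and, mem_insert]
    by_cases hk : k = i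
    · subst hk
      simp [hWi]
    · simp [hk, hW]
  · intro R hR
    simp only [topCount_eq P.pos]
    refine card_le_card fun k hk => ?_
    simp only [mem_filter, mem_univ, true_and] at hk ⊢
    by_cases h : k = i
    · subst h
      exact absurd (hk.symm.trans hi) hR
    · rw [hW k h, hk]

theorem card_changed_trans {m n : ℕ} (U V W : Fin n → Ranking m) :
    #(changed W U) ≤ #(changed W V) + #(changed V U) := by
  classical
  refine (card_le_card fun i hi => ?_).trans (card_union_le _ _)
  simp only [mem_filter, mem_univ, true_and, mem_union, changed] at hi ⊢
  by_contra! h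
  exact hi (h.1.trans h.2)

theorem exists_move {m n : ℕ} (hm : m ≠ 1) (P : Fin m) (k : ℕ) :
    ∀ (V : Fin n → Ranking m) (x : Fin m → ℕ), k ≤ topCount V P →
      ∑ Q ∈ univ.erase P, x Q ≤ k → ∃ W, #(changed W V) ≤ k ∧ topCount W P + k = topCount V P ∧
        ∀ Q, Q ≠ P → topCount V Q + x Q ≤ topCount W Q := by
  classical
  induction k with
  | zero =>
    intro V x _ hx
    refine ⟨V, by simp [changed], rfl, fun Q hQ => ?_⟩
    have := single_le_sum (fun Q _ => Nat.zero_le (x Q)) (mem_erase.2 ⟨hQ, mem_univ Q⟩)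
    omega
  | succ k ih =>
    intro V x hk hx
    -- The next vote goes to a party with unmet demand. Once all demands are met, a surplus vote
    -- goes to any other party, which exists because `m ≠ 1`.
    obtain ⟨Q, hQ, hQx⟩ : ∃ Q, Q ≠ P ∧ (0 < x Q ∨ ∀ R, R ≠ P → x R = 0) := by
      by_cases h : ∃ Q, Q ≠ P ∧ 0 < x Q
      · obtain ⟨Q, h1, h2⟩ := h
        exact ⟨Q, h1, .inl h2⟩
      · push Not at h
        have : Nontrivial (Fin m) := Fin.nontrivial_iff_two_le.2 (by have := P.pos; omega)
        obtain ⟨Q, hQ⟩ := exists_ne P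
        exact ⟨Q, hQ, .inr fun R hR => Nat.le_zero.1 (h R hR)⟩
    obtain ⟨V', h1, h2, h3, h4⟩ := exists_move_one V hQ (by omega)
    have hx' : ∑ R ∈ univ.erase P, Function.update x Q (x Q - 1) R ≤ k := by
      have hmem : Q ∈ univ.erase P := mem_erase.2 ⟨hQ, mem_univ Q⟩
      rcases hQx with h | h
      · rw [← add_sum_erase _ _ hmem] at hx ⊢
        rw [sum_congr rfl fun R hR => Function.update_of_ne (ne_of_mem_erase hR) _ _,
          Function.update_self]
        omega
      · rw [sum_eq_zero fun R hR => ?_]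
        · exact Nat.zero_le k
        · rw [Function.update_apply]
          split_ifs
          · simp [h Q hQ]
          · exact h R (ne_of_mem_erase hR)
    obtain ⟨W, g1, g2, g3⟩ := ih V' _ (by omega) hx'
    refine ⟨W, (card_changed_trans V V' W).trans (by omega), by omega, fun R hR => ?_⟩
    have := g3 R hR
    by_cases h : R = Q
    · subst h
      rw [Function.update_self] at this
      omega
    · rw [Function.update_of_ne h] at this
      have := h4 R hR
      omega

/-! ### The knapsack problem -/

/-- The maximum of `∑ k < m, G k (y k)` over all `y` with `∑ k < m, y k ≤ x`. -/
def knapsack (G : ℕ → ℕ → ℕ) : ℕ → ℕ → ℕ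
  | 0, _ => 0
  | k + 1, x => (range (x + 1)).sup fun y => knapsack G k (x - y) + G k y

theorem sum_le_knapsack (G : ℕ → ℕ → ℕ) (m : ℕ) : ∀ (x : ℕ) (y : ℕ → ℕ),
    ∑ k ∈ range m, y k ≤ x → ∑ k ∈ range m, G k (y k) ≤ knapsack G m x := by
  induction m with
  | zero => simp
  | succ m ih =>
    intro x y h
    rw [sum_range_succ] at h ⊢
    refine (Nat.add_le_add_right (ih (x - y m) y (by omega)) _).trans ?_
    exact le_sup (f := fun y => knapsack G m (x - y) + G m y) (mem_range.2 (by omega))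

theorem exists_sum_eq_knapsack (G : ℕ → ℕ → ℕ) (m : ℕ) : ∀ x : ℕ,
    ∃ y : ℕ → ℕ, ∑ k ∈ range m, y k ≤ x ∧ ∑ k ∈ range m, G k (y k) = knapsack G m x := by
  induction m with
  | zero => exact fun x => ⟨fun _ => 0, by simp, rfl⟩
  | succ m ih =>
    intro x
    obtain ⟨z, hz, he⟩ := exists_mem_eq_sup (range (x + 1)) nonempty_range_add_one
      fun y => knapsack G m (x - y) + G m y
    rw [mem_range] at hz
    obtain ⟨y, h1, h2⟩ := ih (x - z)
    have h3 : ∀ k ∈ range m, Function.update y m z k = y k := fun k hk =>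
      Function.update_of_ne (mem_range.1 hk).ne _ _
    refine ⟨Function.update y m z, ?_, ?_⟩
    · rw [sum_range_succ, Function.update_self, sum_congr rfl h3]
      exact (Nat.add_le_add_right h1 z).trans (by omega)
    · rw [sum_range_succ, Function.update_self, knapsack, he, ← h2]
      congr 1
      exact sum_congr rfl fun k hk => by rw [h3 k hk]

/-! ### Successful campaigns -/

namespace DAB

variable (I : DAB)

theorem m_pos : 0 < I.m := I.target.pos

/-- The number of votes whose top choice is the party with index `k`. -/
def count (k : ℕ) : ℕ := #{i | (I.votes i ⟨0, I.m_pos⟩ : ℕ) = k}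

/-- The number of votes that can be moved. -/
def budget : ℕ := if I.m = 1 then 0 else I.K

/-- The number of votes of the distinguished party, after the maximum number was moved. -/
def rest : ℕ := I.count I.target - I.budget

/-- The number of entries of party `k` before entry `ℓ + 1` of the distinguished party, if `y` votes
are moved to party `k`. -/
noncomputable def gain (d : ℕ → ℝ) (k y : ℕ) : ℕ :=
  if k = I.target then 0 else if I.τ ≤ I.count k + y then
    entriesBefore d I.κ I.ℓ I.rest (k < I.target) (I.count k + y) else 0

theorem count_eq (P : Fin I.m) : I.count P = topCount I.votes P := by
  rw [topCount_eq I.m_pos]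
  simp only [count, Fin.val_inj]

theorem support_of_le {m n : ℕ} {V : Fin n → Ranking m} {τ : ℕ} {P : Fin m}
    (h : τ ≤ topCount V P) : support V τ P = topCount V P := if_pos h

/-- No campaign can leave the target with fewer than `rest` votes or give the others more than
`budget` additional votes in total, and by monotonicity it is best to reach both bounds at once. The
case `rest = 0` is listed separately because `τ` may be `0`. -/
theorem hasSuccessfulCampaign_iff {d : ℕ → ℝ} (hd : IsDivisorSequence d) :
    I.HasSuccessfulCampaign d ↔
      I.rest < I.τ ∨ I.rest = 0 ∨ I.κ ≤ I.ℓ + knapsack (I.gain d) I.m I.budget := by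
  classical
  constructor
  · rintro ⟨V, hV, hs⟩
    -- A single party admits only one ranking, so nothing can change there.
    replace hV : #(changed V I.votes) ≤ I.budget := by
      unfold budget
      split_ifs with h
      · rw [Nat.le_zero, card_eq_zero, changed, filter_eq_empty_iff]
        intro i _
        have : Subsingleton (Fin I.m) := by rw [h]; infer_instance
        simpa using Equiv.ext fun _ => Subsingleton.elim _ _
      · convert hV
        rw [changed]
    by_contra! h
    obtain ⟨h1, h2, h3⟩ := h
    have h4 : I.rest ≤ topCount V I.target := by
      have := topCount_le_add_changed V I.votes I.target
      rw [rest, count_eq]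
      omega
    have h5 := support_of_le (h1.trans h4)
    rw [seats_le_iff hd _ (by omega) I.ℓ_le, h5] at hs
    refine absurd (hs.trans (Nat.add_le_add_left ?_ _)) h3.not_ge
    -- The weight of a party is the number of changed votes that now have it on top; the fibers of
    -- the top choice partition the changed votes.
    have hle := sum_le_knapsack (I.gain d) I.m I.budget
      (fun k => #{i ∈ changed V I.votes | (V i ⟨0, I.m_pos⟩ : ℕ) = k}) (by
        refine le_trans (le_of_eq ?_) hV
        rw [card_eq_sum_card_fiberwise (f := fun i => (V i ⟨0, I.m_pos⟩ : ℕ)) (t := range I.m)]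
        intro i _
        simp)
    refine le_trans ?_ hle
    rw [sum_range fun k => I.gain d k _, ← add_sum_erase _ _ (mem_univ I.target)]
    refine le_trans (sum_le_sum fun Q hQ => ?_) (Nat.le_add_left _ _)
    have hne : (Q : ℕ) ≠ I.target := fun h => ne_of_mem_erase hQ (Fin.ext h)
    have hc := topCount_le_add_changed_filter V I.votes Q
    rw [← I.count_eq] at hc
    simp only [Fin.ext_iff] at hc
    rw [gain, if_neg hne, support]
    split_ifs with h6 h7
    · exact entriesBefore_mono hd _ _ _ h4 hc
    · omega
    · rw [entriesBefore_zero hd _ _ (by omega)]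
      exact Nat.zero_le _
    · exact (entriesBefore_zero hd _ _ (by omega) _).le
  · intro h
    obtain ⟨y, hy, he⟩ := exists_sum_eq_knapsack (I.gain d) I.m I.budget
    rw [sum_range, ← add_sum_erase _ _ (mem_univ I.target)] at hy he
    -- The optimal distribution `y` is only needed if the target keeps votes. If `K` exceeds its
    -- votes, all of them are moved and `y` plays no role.
    obtain ⟨W, h1, h2, h3⟩ : ∃ W : Fin I.n → Ranking I.m, #(changed W I.votes) ≤ I.K ∧
        topCount W I.target = I.rest ∧
        (I.rest ≠ 0 → ∀ Q, Q ≠ I.target → topCount I.votes Q + y Q ≤ topCount W Q) := by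
      by_cases hm : I.m = 1
      · have hb : I.budget = 0 := if_pos hm
        refine ⟨I.votes, by simp [changed], by simp [rest, hb, count_eq], fun _ Q hQ => ?_⟩
        have : Subsingleton (Fin I.m) := by rw [hm]; infer_instance
        exact absurd (Subsingleton.elim _ _) hQ
      have hb : I.budget = I.K := if_neg hm
      by_cases hK : I.K ≤ topCount I.votes I.target
      · obtain ⟨W, h1, h2, h3⟩ := exists_move hm I.target I.K I.votes (fun Q => y Q) hK (by omega)
        refine ⟨W, h1, ?_, fun _ => h3⟩
        rw [rest, count_eq]
        omega
      · obtain ⟨W, h1, h2, h3⟩ := exists_move hm I.target _ I.votes (fun Q => 0) le_rfl (by simp)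
        have : I.rest = 0 := by
          rw [rest, count_eq]
          omega
        exact ⟨W, by omega, by omega, fun h => absurd this h⟩
    refine ⟨W, by convert h1; rw [changed], ?_⟩
    by_cases h0 : support W I.τ I.target = 0
    · simp [seats, h0]
    have hτ : I.τ ≤ topCount W I.target := by
      by_contra hτ
      exact h0 (if_neg hτ)
    have hσ := support_of_le hτ
    rw [hσ, h2] at h0
    rw [h2] at hτ
    rw [seats_le_iff hd _ (by omega) I.ℓ_le, hσ, h2]
    refine ((h.resolve_left hτ.not_gt).resolve_left h0).trans (Nat.add_le_add_left ?_ _)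
    rw [← he, gain, if_pos rfl, zero_add]
    refine sum_le_sum fun Q hQ => ?_
    rw [gain]
    split_ifs with h5 h6
    · exact Nat.zero_le _
    · have := h3 h0 Q (ne_of_mem_erase hQ)
      rw [count_eq] at h6 ⊢
      rw [support_of_le (h6.trans this)]
      exact entriesBefore_mono hd _ _ _ le_rfl this
    · exact Nat.zero_le _

end DAB

end Apportionment

namespace Apportionment

open Finset RAM

/-! ### The program -/

/-- Increments the variable `14` if entry `j` of the fraction list of a party with support `c` comes
before entry `ℓ + 1` of the distinguished party, where `j` and `c` are the variables `17` and `16`,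
and then decrements `j`. -/
def entryStep (cmp : Prog) : Prog :=
  .seq (.cond 15
    (.seq (.seq (.plus 20 8 10) (.seq (.plus 21 16 10) (.seq (.plus 22 6 9) (.plus 23 17 10))))
      (.seq cmp (.cond 24 (.plus 14 14 9) (.plus 14 14 10))))
    (.seq (.seq (.plus 20 16 10) (.seq (.plus 21 8 10) (.seq (.plus 22 17 10) (.plus 23 6 9))))
      (.seq cmp (.cond 24 (.plus 14 14 10) (.plus 14 14 9)))))
    (.minus 17 17 9)

/-- Computes `entriesBefore` into the variable `14`. -/
def countEntries (cmp : Prog) : Prog :=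
  .seq (.seq (.const 14 0) (.plus 17 4 10)) (.loop 17 (entryStep cmp))

/-- Computes the gain of the party in the variable `12` from the number of votes in the variable `13`
into the variable `14`. -/
def computeGain (cmp : Prog) : Prog :=
  .seq (.seq (.const 14 0) (.seq (.minus 18 12 5) (.seq (.minus 15 5 12) (.plus 18 18 15))))
    (.cond 18 (.seq (.seq (.load 16 1 12) (.seq (.plus 16 16 13) (.minus 18 3 16)))
      (.cond 18 (.const 14 0) (countEntries cmp))) (.const 14 0))

/-- Computes all gains of the party in the variable `12` into the array `3`. -/
def gainRow (cmp : Prog) : Prog :=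
  .seq (.plus 13 7 9)
    (.loop 13 (.seq (.minus 13 13 9) (.seq (computeGain cmp) (.store 3 13 14))))

/-- One step in the computation of the maximum of a knapsack entry. -/
def maxStep : Prog :=
  .seq (.minus 17 17 9) (.seq (.load 18 3 17) (.seq (.minus 19 13 17) (.seq (.load 19 2 19)
    (.seq (.plus 18 18 19) (.seq (.minus 18 18 14) (.plus 14 14 18))))))

/-- Replaces the knapsack entries in the array `2` by those with one more party, whose gains are in
the array `3`. -/
def knapsackRow : Prog :=
  .seq (.plus 13 7 9) (.loop 13 (.seq (.seq (.minus 13 13 9) (.seq (.const 14 0) (.plus 17 13 9)))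
    (.seq (.loop 17 maxStep) (.store 2 13 14))))

/-- Computes the knapsack entries for all parties into the array `2`. -/
def computeKnapsack (cmp : Prog) : Prog :=
  .seq (.plus 11 1 10) (.loop 11 (.seq (.minus 12 1 11)
    (.seq (gainRow cmp) (.seq knapsackRow (.minus 11 11 9)))))

/-- Loads the numbers of the instance into the variables `1`, …, `7`. -/
def setup : Prog :=
  .seq (.const 9 1) (.seq (.const 10 0) (.seq (.const 18 0) (.seq (.load 1 0 18)
    (.seq (.const 18 1) (.seq (.load 2 0 18) (.seq (.const 18 2) (.seq (.load 3 0 18)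
      (.seq (.const 18 3) (.seq (.load 4 0 18) (.seq (.const 18 4) (.seq (.load 5 0 18)
        (.seq (.const 18 5) (.seq (.load 6 0 18) (.seq (.const 18 6) (.seq (.load 7 0 18)
          (.seq (.const 18 7) (.plus 12 2 10)))))))))))))))))

/-- Counts the top choice of one vote in the array `1`. -/
def countStep : Prog :=
  .seq (.load 13 0 18) (.seq (.load 14 1 13) (.seq (.plus 14 14 9) (.seq (.store 1 13 14)
    (.seq (.plus 18 18 1) (.minus 12 12 9)))))

/-- Computes the number of votes that can be moved into the variable `7`, and the remaining number of
votes of the distinguished party into the variable `8`. -/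
def prepare : Prog :=
  .seq (.minus 18 1 9) (.seq (.cond 18 (.const 18 0) (.const 7 0)) (.seq (.load 8 1 5)
    (.seq (.minus 8 8 7) (.minus 18 3 8))))

/-- Compares the knapsack value to the number of seats. -/
def conclude : Prog :=
  .seq (.minus 11 4 6) (.seq (.load 18 2 7) (.seq (.minus 11 11 18)
    (.cond 11 (.const 0 0) (.const 0 1))))

/-- Decides the existence of a successful campaign. -/
def decideCampaign (cmp : Prog) : Prog :=
  .seq setup (.seq (.loop 12 countStep) (.seq prepare (.cond 18 (.const 0 1)
    (.cond 8 (.seq (computeKnapsack cmp) conclude) (.const 0 1)))))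

/-! ### Correctness -/

/-- The memory holds the data of the instance. -/
structure DAB.Loaded (I : DAB) (s : State) : Prop where
  m : s.var 1 = I.m
  τ : s.var 3 = I.τ
  κ : s.var 4 = I.κ
  target : s.var 5 = I.target
  ℓ : s.var 6 = I.ℓ
  budget : s.var 7 = I.budget
  rest : s.var 8 = I.rest
  one : s.var 9 = 1
  zero : s.var 10 = 0
  count : s.arr 1 = I.count

theorem DAB.Loaded.of_frame {I : DAB} {s s' : State} {p : Prog} (h : I.Loaded s)
    (hF : Frame p s' s) (hv : ∀ x < 11, p.keepsVar x = true) (ha : p.keepsArr 1 = true) :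
    I.Loaded s' where
  m := (hF.1 1 (hv _ (by omega))).trans h.m
  τ := (hF.1 3 (hv _ (by omega))).trans h.τ
  κ := (hF.1 4 (hv _ (by omega))).trans h.κ
  target := (hF.1 5 (hv _ (by omega))).trans h.target
  ℓ := (hF.1 6 (hv _ (by omega))).trans h.ℓ
  budget := (hF.1 7 (hv _ (by omega))).trans h.budget
  rest := (hF.1 8 (hv _ (by omega))).trans h.rest
  one := (hF.1 9 (hv _ (by omega))).trans h.one
  zero := (hF.1 10 (hv _ (by omega))).trans h.zero
  count := (hF.2 1 ha).trans h.count

theorem DAB.count_le (I : DAB) (k : ℕ) : I.count k ≤ I.n :=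
  (card_filter_le _ _).trans (by simp)

theorem DAB.rest_le (I : DAB) : I.rest ≤ I.n := (Nat.sub_le _ _).trans (I.count_le _)

theorem DAB.budget_le (I : DAB) : I.budget ≤ I.n := by
  unfold budget
  split_ifs
  exacts [Nat.zero_le _, I.K_le]

open Classical in
-- A nonzero variable `15` marks a party that wins ties, for which the test is non-strict. The
-- strict test is the negated comparison with exchanged sides, hence the exchanged increments in
-- `entryStep`.
theorem Compares.exec_entryStep {d : ℕ → ℝ} {cmp : Prog} {T : Polynomial ℕ}
    (hc : Compares d cmp T) (s : State) (h9 : s.var 9 = 1) (h10 : s.var 10 = 0)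
    (h17 : 1 ≤ s.var 17) {N : ℕ} (hN : s.var 8 + s.var 16 + (s.var 6 + 1) + s.var 17 ≤ N) :
    Exec (entryStep cmp) s (T.eval N + 9) fun s' => s'.var 17 = s.var 17 - 1 ∧
      s'.var 14 = s.var 14 + if (if s.var 15 ≠ 0 then
        (s.var 8 : ℝ) * d (s.var 17) ≤ s.var 16 * d (s.var 6 + 1) else
        (s.var 8 : ℝ) * d (s.var 17) < s.var 16 * d (s.var 6 + 1)) then 1 else 0 := by
  refine (Exec.seq (R := fun u => u.var 9 = 1 ∧ u.var 17 = s.var 17 ∧ u.var 14 = s.var 14 +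
    if (if s.var 15 ≠ 0 then
        (s.var 8 : ℝ) * d (s.var 17) ≤ s.var 16 * d (s.var 6 + 1) else
        (s.var 8 : ℝ) * d (s.var 17) < s.var 16 * d (s.var 6 + 1)) then 1 else 0)
    (Exec.cond (B := T.eval N + 7) (fun h => ?_) fun h => ?_) fun u hu =>
      Exec.of_eval rfl ?_).weaken (B' := T.eval N + 9) ?_ fun _ h => h
  · refine (Exec.eval_seq rfl ((hc.exec _ ?_ ?_).frame.seq fun u hu =>
      Exec.of_eval rfl ?_)).weaken ?_ fun _ h => h
    · simp [Prog.eval, h9]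
    · simpa [Prog.eval, h9, h10] using h17
    · obtain ⟨hu1, hu2, -⟩ := hu
      have v (x : ℕ) (hx : x < 20) := hu2 x (hc.keepsVar x hx)
      simp [Prog.eval, h9, h10] at hu1 v
      by_cases h0 : u.var 24 = 0
      · rw [iff_false_left (by simpa using h0), not_le] at hu1
        simp [Prog.eval, h0, v, h9, h10, h, hu1.not_ge]
      · rw [iff_true_left h0] at hu1
        simp [Prog.eval, h0, v, h9, h, hu1]
    · have := eval_le_eval T (a := s.var 8 + s.var 16 + (s.var 6 + 1) + s.var 17) hN
      simp [Prog.cost, Prog.eval, h9, h10, add_comm, add_left_comm] at this ⊢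
      omega
  · refine (Exec.eval_seq rfl ((hc.exec _ ?_ ?_).frame.seq fun u hu =>
      Exec.of_eval rfl ?_)).weaken ?_ fun _ h => h
    · simpa [Prog.eval, h9, h10] using h17
    · simp [Prog.eval, h9]
    · obtain ⟨hu1, hu2, -⟩ := hu
      have v (x : ℕ) (hx : x < 20) := hu2 x (hc.keepsVar x hx)
      simp [Prog.eval, h9, h10] at hu1 v
      by_cases h0 : u.var 24 = 0
      · rw [iff_false_left (by simpa using h0), not_le] at hu1
        simp [Prog.eval, h0, v, h9, h, hu1]
      · rw [iff_true_left h0] at hu1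
        simp [Prog.eval, h0, v, h9, h10, h, hu1.not_gt]
    · have := eval_le_eval T
        (a := s.var 16 + s.var 8 + s.var 17 + (s.var 6 + 1)) (b := N) (by omega)
      simp [Prog.cost, Prog.eval, h9, h10, add_comm, add_left_comm] at this ⊢
      omega
  · simp [Prog.eval, hu]
  · simp [Prog.cost]

theorem Compares.exec_countEntries {d : ℕ → ℝ} {cmp : Prog} {T : Polynomial ℕ}
    (hc : Compares d cmp T) (I : DAB) (s : State) (hs : I.Loaded s)
    (hn : s.var 16 ≤ 2 * I.n) :
    Exec (countEntries cmp) s (I.n * (T.eval (5 * I.n) + 10) + 3) fun s' =>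
      s'.var 14 = entriesBefore d I.κ I.ℓ I.rest (s.var 15 ≠ 0) (s.var 16) := by
  classical
  have hκ := I.seats_lt
  have hℓ := I.ℓ_le
  have hr := I.rest_le
  -- The index `j` descends from `κ`. The bound `5 * I.n` covers the four arguments: `rest`, `ℓ + 1`
  -- and `j` are at most `n`, and the support is at most `2 * n`.
  refine (Exec.eval_seq rfl (Exec.countdown (B := T.eval (5 * I.n) + 9) (fun r u => u.var 14 =
    #{j ∈ Ioc r I.κ | if s.var 15 ≠ 0 then (I.rest : ℝ) * d j ≤ s.var 16 * d (I.ℓ + 1) else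
      (I.rest : ℝ) * d j < s.var 16 * d (I.ℓ + 1)}) I.κ _ ?_ ?_ ?_)).weaken ?_ ?_
  · simp [Prog.eval, hs.κ, hs.zero]
  · simp [Prog.eval]
  · intro r hrκ u h17 h14 hF
    have v (x : ℕ) (hx : x < 20) (h1 : x ≠ 14) (h2 : x ≠ 17) : u.var x = s.var x := by
      rw [hF.1 x]
      · simp [Prog.eval, h1, h2]
      · simp [entryStep, Prog.keepsVar, hc.keepsVar x hx]
        omega
    have e6 : u.var 6 = I.ℓ := by simp [v, hs.ℓ]
    have e8 : u.var 8 = I.rest := by simp [v, hs.rest]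
    have e15 : u.var 15 = s.var 15 := by simp [v]
    have e16 : u.var 16 = s.var 16 := by simp [v]
    refine (hc.exec_entryStep u ?_ ?_ ?_ (N := 5 * I.n) ?_).weaken le_rfl ?_
    · simp [v, hs.one]
    · simp [v, hs.zero]
    · omega
    · omega
    · rintro w ⟨h1, h2⟩
      refine ⟨by omega, ?_⟩
      have : Ioc r I.κ = insert (r + 1) (Ioc (r + 1) I.κ) := by
        ext j
        simp only [mem_Ioc, mem_insert]
        omega
      rw [this, filter_insert, h2, h14, h17]
      simp only [e6, e8, e15, e16]
      split_ifs with h3 h4 h4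
      · rw [card_insert_of_notMem (by simp)]
      · rfl
      · rw [card_insert_of_notMem (by simp)]
      · rfl
  · have : I.κ * (T.eval (5 * I.n) + 9 + 1) ≤ I.n * (T.eval (5 * I.n) + 10) :=
      Nat.mul_le_mul_right _ hκ.le
    simp only [Prog.cost]
    omega
  · intro u hu
    rw [hu, entriesBefore, show Icc 1 I.κ = Ioc 0 I.κ from rfl]
    congr!

theorem keepsVar_computeGain {d : ℕ → ℝ} {cmp : Prog} {T : Polynomial ℕ} (hc : Compares d cmp T)
    {x : ℕ} (hx : x < 14) : (computeGain cmp).keepsVar x = true := by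
  simp [computeGain, countEntries, entryStep, Prog.keepsVar, hc.keepsVar x (by omega)]
  omega

theorem keepsArr_computeGain {d : ℕ → ℝ} {cmp : Prog} {T : Polynomial ℕ} (hc : Compares d cmp T)
    {b : ℕ} (hb : b < 10) : (computeGain cmp).keepsArr b = true := by
  simp [computeGain, countEntries, entryStep, Prog.keepsArr, hc.keepsArr b hb]

/-- The sum of the two truncated differences of the indices vanishes only for the target. The
difference in variable `15` is positive exactly for parties of lower index and so doubles as the
tie-breaking flag. -/
theorem Compares.exec_computeGain {d : ℕ → ℝ} {cmp : Prog} {T : Polynomial ℕ}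
    (hc : Compares d cmp T) (I : DAB) (s : State) (hs : I.Loaded s) (hy : s.var 13 ≤ I.n) :
    Exec (computeGain cmp) s (I.n * (T.eval (5 * I.n) + 10) + 12) fun s' =>
      s'.var 14 = I.gain d (s.var 12) (s.var 13) := by
  have hcount := I.count_le (s.var 12)
  refine (Exec.eval_seq rfl (Exec.cond (B := I.n * (T.eval (5 * I.n) + 10) + 7)
    (fun h => ?_) fun h => ?_)).weaken ?_ fun _ h => h
  · have hne : s.var 12 ≠ I.target := by
      intro h'
      simp [Prog.eval, hs.target, h'] at h
    refine (Exec.eval_seq rfl (Exec.cond (B := I.n * (T.eval (5 * I.n) + 10) + 3)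
      (fun h' => ?_) fun h' => ?_)).weaken ?_ fun _ h => h
    · refine (Exec.of_eval rfl ?_).weaken ?_ fun _ h => h
      · have : ¬ I.τ ≤ I.count (s.var 12) + s.var 13 := by
          simp [Prog.eval, hs.τ, hs.count] at h'
          omega
        simp [Prog.eval, DAB.gain, this]
      · simp [Prog.cost]
    · refine (hc.exec_countEntries I _ ⟨?_, ?_, ?_, ?_, ?_, ?_, ?_, ?_, ?_, ?_⟩ ?_).weaken le_rfl ?_
      · simp [Prog.eval, hs.m]
      · simp [Prog.eval, hs.τ]
      · simp [Prog.eval, hs.κ]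
      · simp [Prog.eval, hs.target]
      · simp [Prog.eval, hs.ℓ]
      · simp [Prog.eval, hs.budget]
      · simp [Prog.eval, hs.rest]
      · simp [Prog.eval, hs.one]
      · simp [Prog.eval, hs.zero]
      · simp [Prog.eval, hs.count]
      · simp [Prog.eval, hs.count]
        omega
      · intro u hu
        have : I.τ ≤ I.count (s.var 12) + s.var 13 := by
          simp [Prog.eval, hs.τ, hs.count] at h'
          omega
        simp [Prog.eval, hs.count, hs.target] at hu
        rw [hu, DAB.gain, if_neg hne, if_pos this]
        simp only [← Nat.pos_iff_ne_zero, Nat.sub_pos_iff_lt]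
    · simp only [Prog.cost]
      omega
  · have he : s.var 12 = I.target := by
      simp [Prog.eval, hs.target] at h
      omega
    refine (Exec.of_eval rfl ?_).weaken ?_ fun _ h => h
    · simp [Prog.eval, DAB.gain, he]
    · simp [Prog.cost]
  · simp only [Prog.cost]
    omega

theorem Compares.exec_gainRow {d : ℕ → ℝ} {cmp : Prog} {T : Polynomial ℕ}
    (hc : Compares d cmp T) (I : DAB) (s : State) (hs : I.Loaded s) :
    Exec (gainRow cmp) s ((I.n + 1) * (I.n * (T.eval (5 * I.n) + 10) + 15) + 2) fun s' =>
      ∀ y ≤ I.budget, s'.arr 3 y = I.gain d (s.var 12) y := by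
  have hb := I.budget_le
  refine (Exec.eval_seq rfl (Exec.countdown (B := I.n * (T.eval (5 * I.n) + 10) + 14)
    (fun r u => ∀ y, r ≤ y → y ≤ I.budget → u.arr 3 y = I.gain d (s.var 12) y)
    (I.budget + 1) _ ?_ ?_ ?_)).weaken ?_ ?_
  · simp [Prog.eval, hs.budget, hs.one]
  · intro y h1 h2
    omega
  · intro r hr u h13 h3 hF
    have kv (x : ℕ) (hx : x < 13) : (Prog.loop 13 (.seq (.minus 13 13 9)
        (.seq (computeGain cmp) (.store 3 13 14)))).keepsVar x = true := by
      simp [Prog.keepsVar, keepsVar_computeGain hc (show x < 14 by omega)]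
      omega
    have hu : I.Loaded u := by
      refine (hs.of_frame (Prog.frame_eval (p := .plus 13 7 9) rfl s) ?_ rfl).of_frame hF
        (fun x hx => kv x (by omega)) ?_
      · simp [Prog.keepsVar]
        omega
      · simp [Prog.keepsArr, keepsArr_computeGain hc]
    have h12 : u.var 12 = s.var 12 := by
      rw [hF.1 12 (kv 12 (by omega))]
      simp [Prog.eval]
    have hu' : I.Loaded ((Prog.minus 13 13 9).eval u) := by
      refine hu.of_frame (Prog.frame_eval rfl u) ?_ rfl
      simp [Prog.keepsVar]
      omega
    refine (Exec.eval_seq rfl ((hc.exec_computeGain I _ hu' ?_).frame.seq fun w hw =>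
      Exec.of_eval rfl ?_)).weaken ?_ fun _ h => h
    · simp [Prog.eval, h13, hu.one]
      omega
    · obtain ⟨hw1, hw2, hw3⟩ := hw
      have e13 := hw2 13 (keepsVar_computeGain hc (by omega))
      have e3 := hw3 3 (keepsArr_computeGain hc (by omega))
      simp [Prog.eval, h13, hu.one, h12] at hw1 e13 e3
      refine ⟨by simp [Prog.eval, e13], fun y h1 h2 => ?_⟩
      rcases h1.eq_or_lt with rfl | h1
      · simp [Prog.eval, e13, hw1]
      · simp [Prog.eval, e13, h1.ne', e3, h3 y h1 h2]
    · simp only [Prog.cost]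
      omega
  · have : (I.budget + 1) * (I.n * (T.eval (5 * I.n) + 10) + 14 + 1) ≤
        (I.n + 1) * (I.n * (T.eval (5 * I.n) + 10) + 15) := Nat.mul_le_mul_right _ (by omega)
    simp only [Prog.cost]
    omega
  · exact fun u hu y hy => hu y (Nat.zero_le y) hy

/-- Truncated subtraction yields the maximum: `a + (b - a) = max a b`. -/
theorem exec_loop_maxStep (s : State) (x : ℕ) (h9 : s.var 9 = 1) (h13 : s.var 13 = x)
    (h14 : s.var 14 = 0) (h17 : s.var 17 = x + 1) :
    Exec (.loop 17 maxStep) s ((x + 1) * 8 + 1) fun s' =>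
      s'.var 14 = (range (x + 1)).sup fun y => s.arr 2 (x - y) + s.arr 3 y := by
  refine (Exec.countdown (B := 7) (fun r u => u.var 14 =
    (Ico r (x + 1)).sup fun y => s.arr 2 (x - y) + s.arr 3 y) (x + 1) s h17 ?_ ?_).weaken le_rfl ?_
  · simpa using h14
  · intro r hr u hu h hF
    refine Exec.of_eval rfl ?_
    have e9 := hF.1 9 rfl
    have e13 := hF.1 13 rfl
    have e2 := hF.2 2 rfl
    have e3 := hF.2 3 rfl
    refine ⟨by simp [maxStep, Prog.eval, hu, e9, h9], ?_⟩
    have : Ico r (x + 1) = insert r (Ico (r + 1) (x + 1)) := by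
      ext j
      simp only [mem_Ico, mem_insert]
      omega
    rw [this, sup_insert, ← h]
    simp [maxStep, Prog.eval, hu, e9, h9, e13, h13, e2, e3]
    omega
  · intro u hu
    rw [hu, range_eq_Ico]

/-- The row is updated in place. A new entry `x` uses only old entries up to `x`, so processing `x`
downwards overwrites nothing that is still needed. -/
theorem exec_knapsackRow (I : DAB) (s : State) (hs : I.Loaded s) :
    Exec knapsackRow s ((I.n + 1) * ((I.n + 1) * 8 + 6) + 2) fun s' => ∀ x ≤ I.budget,
      s'.arr 2 x = (range (x + 1)).sup fun y => s.arr 2 (x - y) + s.arr 3 y := by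
  have hb := I.budget_le
  refine (Exec.eval_seq rfl (Exec.countdown (B := (I.n + 1) * 8 + 5)
    (fun r u => (∀ x, r ≤ x → x ≤ I.budget →
      u.arr 2 x = (range (x + 1)).sup fun y => s.arr 2 (x - y) + s.arr 3 y) ∧
      ∀ x < r, u.arr 2 x = s.arr 2 x)
    (I.budget + 1) _ ?_ ?_ ?_)).weaken ?_ ?_
  · simp [Prog.eval, hs.budget, hs.one]
  · refine ⟨fun x h1 h2 => by omega, fun x _ => by simp [Prog.eval]⟩
  · rintro r hr u h13 ⟨h1, h2⟩ hF
    have e9 := hF.1 9 rfl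
    have e3 := hF.2 3 rfl
    simp [Prog.eval, hs.one] at e9 e3
    refine (Exec.eval_seq rfl ((exec_loop_maxStep _ r ?_ ?_ ?_ ?_).frame.seq fun w hw =>
      Exec.of_eval rfl ?_)).weaken ?_ fun _ h => h
    · simp [Prog.eval, e9]
    · simp [Prog.eval, h13, e9]
    · simp [Prog.eval]
    · simp [Prog.eval, h13, e9]
    · obtain ⟨hw1, hw2, hw3⟩ := hw
      have f13 := hw2 13 rfl
      have f2 := hw3 2 rfl
      simp [Prog.eval, h13, e9, e3] at hw1 f13 f2
      refine ⟨by simp [Prog.eval, f13], fun x h3 h4 => ?_, fun x hx => ?_⟩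
      · rcases h3.eq_or_lt with rfl | h3
        · simp only [Prog.eval, State.arr_setArr, if_true, f13, Function.update_self, hw1]
          refine sup_congr rfl fun y hy => ?_
          rw [h2 _ (by omega)]
        · simp [Prog.eval, f13, h3.ne', f2, h1 x h3 h4]
      · simp [Prog.eval, f13, hx.ne, f2, h2 x (by omega)]
    · simp only [Prog.cost]
      omega
  · have : (I.budget + 1) * ((I.n + 1) * 8 + 5 + 1) ≤ (I.n + 1) * ((I.n + 1) * 8 + 6) :=
      Nat.mul_le_mul_right _ (by omega)
    simp only [Prog.cost]
    omega
  · exact fun u hu x hx => hu.1 x (Nat.zero_le x) hx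

end Apportionment

/-! ### The full dynamic program and the decision procedure -/

namespace Apportionment

open Finset RAM

theorem keepsVar_gainRow {d : ℕ → ℝ} {cmp : Prog} {T : Polynomial ℕ} (hc : Compares d cmp T)
    {x : ℕ} (hx : x < 13) : (gainRow cmp).keepsVar x = true := by
  simp [gainRow, Prog.keepsVar, keepsVar_computeGain hc (show x < 14 by omega)]
  omega

theorem keepsArr_gainRow {d : ℕ → ℝ} {cmp : Prog} {T : Polynomial ℕ} (hc : Compares d cmp T)
    {b : ℕ} (hb : b < 3) : (gainRow cmp).keepsArr b = true := by
  simp [gainRow, Prog.keepsArr, keepsArr_computeGain hc (show b < 10 by omega)]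
  omega

theorem keepsVar_knapsackRow {x : ℕ} (hx : x < 13) : knapsackRow.keepsVar x = true := by
  simp [knapsackRow, maxStep, Prog.keepsVar]
  omega

/-- A bound for the running time of `computeKnapsack`. -/
def knapsackTime (T : Polynomial ℕ) (n : ℕ) : ℕ :=
  n * ((n + 1) * (n * (T.eval (5 * n) + 10) + 15) + ((n + 1) * ((n + 1) * 8 + 6) + 7)) + 2

theorem Compares.exec_computeKnapsack {d : ℕ → ℝ} {cmp : Prog} {T : Polynomial ℕ}
    (hc : Compares d cmp T) (I : DAB) (s : State) (hs : I.Loaded s) (h2 : s.arr 2 = fun _ => 0) :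
    Exec (computeKnapsack cmp) s (knapsackTime T I.n) fun s' =>
      s'.arr 2 I.budget = knapsack (I.gain d) I.m I.budget ∧ I.Loaded s' := by
  have kv (x : ℕ) (hx : x < 11) : (computeKnapsack cmp).keepsVar x = true := by
    simp [computeKnapsack, Prog.keepsVar, keepsVar_gainRow hc (show x < 13 by omega),
      keepsVar_knapsackRow (show x < 13 by omega)]
    omega
  have ka : (computeKnapsack cmp).keepsArr 1 = true := by
    simp [computeKnapsack, Prog.keepsArr, keepsArr_gainRow hc (show 1 < 3 by omega)]
    rfl
  refine Exec.weaken (Exec.frame (Exec.eval_seq rfl (Exec.countdown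
    (B := (I.n + 1) * (I.n * (T.eval (5 * I.n) + 10) + 15) + ((I.n + 1) * ((I.n + 1) * 8 + 6) + 6))
    (fun r u => ∀ x ≤ I.budget, u.arr 2 x = knapsack (I.gain d) (I.m - r) x) I.m _ ?_ ?_ ?_)))
    ?_ (Q' := fun s' => s'.arr 2 I.budget = knapsack (I.gain d) I.m I.budget ∧ I.Loaded s') ?_
  · simp [Prog.eval, hs.m, hs.zero]
  -- The zero array is the knapsack row for no parties.
  · simp [Prog.eval, h2, knapsack]
  · intro r hr u h11 hI hF
    have hu : I.Loaded u := by
      refine (hs.of_frame (Prog.frame_eval (p := .plus 11 1 10) rfl s) ?_ rfl).of_frame hF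
        (fun x hx => ?_) ?_
      · simp [Prog.keepsVar]
        omega
      · have := kv x hx
        simp only [computeKnapsack, Prog.keepsVar, Bool.and_eq_true] at this ⊢
        exact this.2
      · simpa only [computeKnapsack, Prog.keepsArr, Bool.and_eq_true, true_and] using ka
    have hu₁ : I.Loaded ((Prog.minus 12 1 11).eval u) := by
      refine hu.of_frame (Prog.frame_eval rfl u) ?_ rfl
      simp [Prog.keepsVar]
      omega
    have e12 : ((Prog.minus 12 1 11).eval u).var 12 = I.m - (r + 1) := by
      simp [Prog.eval, hu.m, h11]
    refine (Exec.eval_seq rfl ((hc.exec_gainRow I _ hu₁).frame.seq fun v hv =>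
      Exec.seq (B := (I.n + 1) * ((I.n + 1) * 8 + 6) + 2)
        (R := fun w => w.var 11 = r + 1 ∧ w.var 9 = 1 ∧
          ∀ x ≤ I.budget, w.arr 2 x = knapsack (I.gain d) (I.m - r) x) ?_ fun w hw =>
        Exec.of_eval rfl ?_)).weaken ?_ fun _ h => h
    · obtain ⟨hv1, hv2⟩ := hv
      have hv3 : I.Loaded v := hu₁.of_frame hv2 (fun x hx => keepsVar_gainRow hc (by omega))
        (keepsArr_gainRow hc (by omega))
      refine (exec_knapsackRow I v hv3).frame.weaken le_rfl ?_
      rintro w ⟨hw1, hw2⟩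
      have e11 := hv2.1 11 (keepsVar_gainRow hc (by omega))
      have e2 := hv2.2 2 (keepsArr_gainRow hc (by omega))
      refine ⟨?_, (hw2.1 9 (keepsVar_knapsackRow (by omega))).trans hv3.one, fun x hx => ?_⟩
      · rw [hw2.1 11 (keepsVar_knapsackRow (by omega)), e11]
        simp [Prog.eval, h11]
      · rw [hw1 x hx, show I.m - r = (I.m - (r + 1)) + 1 by omega, knapsack]
        refine sup_congr rfl fun y hy => ?_
        rw [mem_range] at hy
        rw [hv1 y (by omega), e12, e2]
        simp only [Prog.eval, State.arr_setVar]
        rw [hI _ (by omega)]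
    · simpa [Prog.eval, hw.1, hw.2.1] using hw.2.2
    · simp only [Prog.cost]
      omega
  · have : I.m * ((I.n + 1) * (I.n * (T.eval (5 * I.n) + 10) + 15) +
        ((I.n + 1) * ((I.n + 1) * 8 + 6) + 6) + 1) ≤
        I.n * ((I.n + 1) * (I.n * (T.eval (5 * I.n) + 10) + 15) +
          ((I.n + 1) * ((I.n + 1) * 8 + 6) + 7)) :=
      Nat.mul_le_mul I.parties_lt.le (Nat.add_assoc ..).le
    simp only [Prog.cost, knapsackTime]
    omega
  · rintro u ⟨hu1, hu2⟩
    exact ⟨hu1 _ le_rfl, hs.of_frame hu2 kv ka⟩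

/-! ### The input -/

/-- After seven header numbers, the votes form blocks of length `m`, each starting with its top
choice. -/
theorem DAB.encode_vote (I : DAB) (i : Fin I.n) :
    I.encode.getD (7 + i * I.m) 0 = (I.votes i ⟨0, I.m_pos⟩ : ℕ) := by
  have hlen : (i : ℕ) * I.m < I.n * I.m := Nat.mul_lt_mul_of_pos_right i.2 I.m_pos
  rw [encode, List.getD_append_right _ _ _ _ (by simp)]
  have := List.ofFn_mul (m := I.n) (n := I.m)
    fun q => ((I.votes q.divNat q.modNat : Fin I.m) : ℕ)
  have h : ∀ (i : Fin I.n) (j : Fin I.m) (h : (i : ℕ) * I.m + j < I.n * I.m),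
      (⟨i * I.m + j, h⟩ : Fin (I.n * I.m)).divNat = i ∧
        (⟨i * I.m + j, h⟩ : Fin (I.n * I.m)).modNat = j := by
    intro i j h
    constructor <;> ext
    · rw [Fin.coe_divNat]
      change ((i : ℕ) * I.m + j) / I.m = i
      rw [mul_comm, Nat.mul_add_div I.m_pos, Nat.div_eq_of_lt j.2, add_zero]
    · rw [Fin.coe_modNat]
      change ((i : ℕ) * I.m + j) % I.m = j
      rw [mul_comm, Nat.mul_add_mod, Nat.mod_eq_of_lt j.2]
  simp only [h] at this
  rw [← this, List.getD_eq_getElem _ _ (by simpa using hlen), List.getElem_ofFn]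
  have := h i ⟨0, I.m_pos⟩ (by simpa using hlen)
  simp only [add_zero] at this
  simp [this]

/-- Each vote contributes at least one entry to the input, so time bounds may be stated in `n`
alone. -/
theorem DAB.n_le_inputSize (I : DAB) : I.n ≤ inputSize I.encode := by
  have h1 : ∀ w : List ℕ, w.length ≤ inputSize w := by
    intro w
    induction w with
    | nil => simp
    | cons k w ih =>
      simp only [inputSize, List.map_cons, List.sum_cons, List.length_cons] at ih ⊢
      omega
  refine le_trans ?_ (h1 _)
  have : I.n * 1 ≤ I.n * I.m := Nat.mul_le_mul_left _ I.m_pos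
  simp [encode, List.length_flatten, Function.comp_def]
  omega

theorem DAB.exec_loop_countStep (I : DAB) (s : State) (h0 : s.arr 0 = fun i => I.encode.getD i 0)
    (h1 : s.arr 1 = fun _ => 0) (hm : s.var 1 = I.m) (h9 : s.var 9 = 1) (h12 : s.var 12 = I.n)
    (h18 : s.var 18 = 7) :
    Exec (.loop 12 countStep) s (I.n * 7 + 1) fun s' => s'.arr 1 = I.count := by
  -- With `r` votes left, variable `18` points to the top choice of vote `n - r`.
  refine (Exec.countdown (B := 6) (fun r u => u.var 18 = 7 + (I.n - r) * I.m ∧ ∀ k, u.arr 1 k =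
    #{i : Fin I.n | (i : ℕ) < I.n - r ∧ (I.votes i ⟨0, I.m_pos⟩ : ℕ) = k})
    I.n s h12 ?_ ?_).weaken le_rfl ?_
  · simp [h18, h1]
  · rintro r hr u hu ⟨hp, hk⟩ hF
    have e9 := (hF.1 9 rfl).trans h9
    have em := (hF.1 1 rfl).trans hm
    have e0 := (hF.2 0 rfl).trans h0
    let i : Fin I.n := ⟨I.n - (r + 1), by omega⟩
    have hv : I.encode.getD (7 + (I.n - (r + 1)) * I.m) 0 = (I.votes i ⟨0, I.m_pos⟩ : ℕ) :=
      I.encode_vote i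
    have hlt : ∀ x : Fin I.n, (x : ℕ) < I.n - r ↔ x = i ∨ (x : ℕ) < I.n - (r + 1) := by
      intro x
      rw [Fin.ext_iff]
      simp only [i]
      omega
    refine Exec.of_eval rfl ⟨?_, ?_, fun k => ?_⟩
    · simp [countStep, Prog.eval, hu, e9]
    · simp [countStep, Prog.eval, hp, em]
      rw [show I.n - r = I.n - (r + 1) + 1 by omega]
      ring
    · by_cases h : (I.votes i ⟨0, I.m_pos⟩ : ℕ) = k
      · have : ({x : Fin I.n | (x : ℕ) < I.n - r ∧ (I.votes x ⟨0, I.m_pos⟩ : ℕ) = k} : Finset _) =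
            insert i ({x : Fin I.n | (x : ℕ) < I.n - (r + 1) ∧
              (I.votes x ⟨0, I.m_pos⟩ : ℕ) = k} : Finset _) := by
          ext x
          simp only [mem_filter, mem_univ, true_and, mem_insert, hlt]
          constructor
          · tauto
          · rintro (rfl | h') <;> tauto
        rw [this, card_insert_of_notMem (by simp [i]), ← hk]
        simp only [countStep, Prog.eval, State.var_setVar, State.arr_setVar, State.arr_setArr, e0,
          hp, State.var_setArr, e9]
        simp only [hv, h]
        simp
      · have : ({x : Fin I.n | (x : ℕ) < I.n - r ∧ (I.votes x ⟨0, I.m_pos⟩ : ℕ) = k} : Finset _) =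
            ({x : Fin I.n | (x : ℕ) < I.n - (r + 1) ∧
              (I.votes x ⟨0, I.m_pos⟩ : ℕ) = k} : Finset _) := by
          ext x
          simp only [mem_filter, mem_univ, true_and, hlt]
          constructor
          · rintro ⟨rfl | h', h''⟩
            exacts [absurd h'' h, ⟨h', h''⟩]
          · tauto
        rw [this, ← hk]
        simp only [countStep, Prog.eval, State.var_setVar, State.arr_setVar, State.arr_setArr, e0,
          hp, State.var_setArr, e9]
        simp only [hv]
        simp [Ne.symm h]
  · rintro u ⟨-, hu⟩
    funext k
    rw [hu, DAB.count]
    simp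

theorem Compares.exec_decideCampaign {d : ℕ → ℝ} {cmp : Prog} {T : Polynomial ℕ}
    (hc : Compares d cmp T) (hd : IsDivisorSequence d) (I : DAB) :
    Exec (decideCampaign cmp) (start I.encode) (I.n * 7 + knapsackTime T I.n + 40) fun s' =>
      s'.var 0 ≠ 0 ↔ I.HasSuccessfulCampaign d := by
  have e (k : ℕ) (hk : k < 7) : I.encode.getD k 0 =
      [I.m, I.n, I.τ, I.κ, (I.target : ℕ), I.ℓ, I.K].getD k 0 :=
    List.getD_append _ _ _ _ (by simpa using hk)
  have e0 := e 0 (by omega)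
  have e1 := e 1 (by omega)
  have e2 := e 2 (by omega)
  have e3 := e 3 (by omega)
  have e4 := e 4 (by omega)
  have e5 := e 5 (by omega)
  have e6 := e 6 (by omega)
  simp only [List.getD_cons_zero, List.getD_cons_succ] at e0 e1 e2 e3 e4 e5 e6
  set s₁ := setup.eval (start I.encode) with hs₁
  have ha : (start I.encode).arr 0 = fun i => I.encode.getD i 0 := by simp [start]
  obtain ⟨v1, v3, v4, v5, v6, v7, v9, v10, v12, v18⟩ : s₁.var 1 = I.m ∧ s₁.var 3 = I.τ ∧
      s₁.var 4 = I.κ ∧ s₁.var 5 = I.target ∧ s₁.var 6 = I.ℓ ∧ s₁.var 7 = I.K ∧ s₁.var 9 = 1 ∧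
      s₁.var 10 = 0 ∧ s₁.var 12 = I.n ∧ s₁.var 18 = 7 := by
    simp [-List.getD_eq_getElem?_getD, hs₁, setup, Prog.eval, ha, e0, e1, e2, e3, e4, e5, e6]
  have a (b : ℕ) : s₁.arr b = (start I.encode).arr b := by
    simp [hs₁, setup, Prog.eval]
  rw [I.hasSuccessfulCampaign_iff hd]
  refine (Exec.eval_seq rfl ((I.exec_loop_countStep s₁ ?_ ?_ ?_ ?_ ?_ ?_).frame.seq fun u hu =>
    Exec.eval_seq rfl ?_ (B := knapsackTime T I.n + 9))).weaken ?_ fun _ h => h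
  · simp [a, start]
  · simp [a, start]
  · exact v1
  · exact v9
  · exact v12
  · exact v18
  · obtain ⟨hu1, hu2, hu3⟩ := hu
    have w1 := (hu2 1 rfl).trans v1
    have w3 := (hu2 3 rfl).trans v3
    have w4 := (hu2 4 rfl).trans v4
    have w5 := (hu2 5 rfl).trans v5
    have w6 := (hu2 6 rfl).trans v6
    have w7 := (hu2 7 rfl).trans v7
    have w9 := (hu2 9 rfl).trans v9
    have w10 := (hu2 10 rfl).trans v10
    have wa := hu3 2 rfl
    have hp := I.m_pos
    -- The program recognizes a single party by `m - 1 = 0`, which is equivalent to `m = 1` since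
    -- `m` is positive.
    have hbud : (if I.m - 1 = 0 then 0 else I.K) = I.budget := by
      rw [DAB.budget]
      congr 1
      simp only [eq_iff_iff]
      omega
    have x7 : (prepare.eval u).var 7 = I.budget := by
      rw [← hbud]
      simp [prepare, Prog.eval, w1, w9, w7]
    have x8 : (prepare.eval u).var 8 = I.rest := by
      rw [DAB.rest, ← hbud]
      simp [prepare, Prog.eval, w1, w9, w7, w5, hu1]
    have x18 : (prepare.eval u).var 18 = I.τ - I.rest := by
      rw [DAB.rest, ← hbud]
      simp [prepare, Prog.eval, w1, w9, w7, w5, w3, hu1]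
    have hL : I.Loaded (prepare.eval u) := by
      refine ⟨?_, ?_, ?_, ?_, ?_, x7, x8, ?_, ?_, ?_⟩ <;>
        simp [prepare, Prog.eval, w1, w3, w4, w5, w6, w9, w10, hu1]
    refine Exec.cond (B := knapsackTime T I.n + 8) (fun h => ?_) fun h =>
      Exec.cond (B := knapsackTime T I.n + 7) (fun h' => ?_) fun h' => ?_
    · refine (Exec.of_eval rfl ?_).weaken ?_ fun _ h => h
      · rw [x18] at h
        have : I.rest < I.τ := by omega
        simp [Prog.eval, this]
      · simp [Prog.cost]
    · refine ((hc.exec_computeKnapsack I _ hL ?_).seq fun w hw =>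
        Exec.of_eval rfl ?_).weaken ?_ fun _ h => h
      · simp [prepare, Prog.eval, wa, a, start]
      · obtain ⟨hw1, hw2⟩ := hw
        rw [x18] at h
        rw [x8] at h'
        simp [conclude, Prog.eval, hw2.κ, hw2.ℓ, hw2.budget, hw1, h']
        omega
      · simp [conclude, Prog.cost]
    · refine (Exec.of_eval rfl ?_).weaken ?_ fun _ h => h
      · rw [x8] at h'
        simp [Prog.eval, h']
      · simp [Prog.cost]
  · simp [setup, prepare, Prog.cost]
    omega

end Apportionment

theorem mainTheorem2 (d : ℕ → ℝ) (hd : Apportionment.IsDivisorSequence d) :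
    RAM.InP Apportionment.DAB.encode (Apportionment.DAB.HasSuccessfulCampaign d) := by
  obtain ⟨cmp, T, hc⟩ : ∃ cmp T, Apportionment.Compares d cmp T :=
    hd.computable.elim (fun h => h.exists_compares) fun h => h.exists_compares
  let U : Polynomial ℕ := .X * 7 + (.X * ((.X + 1) * (.X * (T.comp (5 * .X) + 10) + 15) +
    ((.X + 1) * ((.X + 1) * 8 + 6) + 7)) + 2) + 40
  have hU (n : ℕ) : U.eval n = n * 7 + Apportionment.knapsackTime T n + 40 := by
    simp [U, Apportionment.knapsackTime]
  refine ⟨Apportionment.decideCampaign cmp, U, fun I => ?_⟩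
  obtain ⟨s, t, h1, h2, h3⟩ := hc.exec_decideCampaign hd I
  exact ⟨s, t, h1, (h2.trans (hU _).ge).trans (RAM.eval_le_eval U I.n_le_inputSize), h3⟩
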